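/- Work over $\mathbb C$, with homogeneous coordinates $x_0,\dots,x_7$ on $\mathbb P^7$, and consider the quadratic forms $$ \begin{aligned} Q_0={}&x_0(x_3+x_5+2x_6+3x_7)+x_1(-x_5+5x_6+2x_7)\\ &-x_2x_3-x_2x_4+x_2x_5+x_3^2-x_4x_6+x_5^2+x_6^2+x_7^2,\\ Q_1={}&x_0(-x_2+3x_5+7x_6+11x_7)+x_1(x_4+9x_5+4x_6+x_7)\\ &+x_2^2-x_2x_3+2x_3x_6+x_4^2+3x_4x_7+2x_5^2+3x_6^2+5x_7^2,\\ Q_2={}&x_0(11x_5+13x_6+8x_7)+x_1(-x_3+6x_5+7x_6+3x_7)\\ &+x_2^2+5x_2x_7-x_3x_4+9x_3x_5+13x_5^2+4x_6^2+11x_7^2. \end{aligned} $$ Let $X\subset\mathbb P^7$ be the closed subscheme $Q_0=Q_1=Q_2=0$. Then: 1. $X$ is smooth over $\mathbb C$, of dimension $4$. 2. $X$ is rational: a dense open subscheme of $X$ is isomorphic over $\mathbb C$ to a dense open subscheme of $\mathbb A^4$. 3. $X$ contains the line $\ell:\ x_2=\dots=x_7=0$. 4. Identify the space of $2$-planes $\Pi\subset\mathbb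 P^7$ containing $\ell$ with $\mathbb P^5$, a point $[y_0:\dots:y_5]$ corresponding to the plane spanned by $\ell$ and $[0:0:y_0:\dots:y_5]$, and let $$Q=\bigl\{([\lambda_0:\lambda_1:\lambda_2],\Pi)\ :\ \ell\subset\Pi\subset\{\lambda_0Q_0+\lambda_1Q_1+\lambda_2Q_2=0\}\bigr\}\subset\mathbb P^2\times\mathbb P^5 .$$ The first projection $Q\to\mathbb P^2$ is a quadric surface bundle: every fibre is a quadric surface in a linear subspace $\mathbb P^3\subset\mathbb P^5$, and the fibres over a nonempty Zariski open subset of $\mathbb P^2$ are smooth quadric surfaces. 5. The map $[\lambda_0:\lambda_1:\lambda_2]\mapsto[\lambda_0:\lambda_1:\lambda_2:0:0:0]\in\mathbb P^5$ is a rational section of $Q\to\mathbb P^2$; that is, the plane spanned by $\ell$ and $[0:0:\lambda_0:\lambda_1:\lambda_2:0:0:0]$ is contained in the quadric $\lambda_0Q_0+\lambda_1Q_1+\lambda_2Q_2=0$. -/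

import Mathlib

open AlgebraicGeometry CategoryTheory MvPolynomial
open scoped HomogeneousIdeal LinearAlgebra.Projectivization

noncomputable section

namespace ThreeQuadrics

attribute [local instance] MvPolynomial.gradedAlgebra

/-! ### Closed subschemes of projective space cut out by homogeneous ideals -/

section Proj

variable {σ : Type} (I : HomogeneousIdeal (homogeneousSubmodule σ ℂ))

/-- The grading on `ℂ[x_σ] / I` induced by the degree, for a homogeneous ideal `I`. -/
def quotGrading (n : ℕ) : Submodule ℂ (MvPolynomial σ ℂ ⧸ I.toIdeal) :=
  (homogeneousSubmodule σ ℂ n).map (Ideal.Quotient.mkₐ ℂ I.toIdeal).toLinearMap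

theorem mk_mem_quotGrading {n : ℕ} {p : MvPolynomial σ ℂ} (hp : p ∈ homogeneousSubmodule σ ℂ n) :
    Ideal.Quotient.mk I.toIdeal p ∈ quotGrading I n :=
  ⟨p, hp, rfl⟩

instance quotGrading_gradedMonoid : SetLike.GradedMonoid (quotGrading I) where
  one_mem := ⟨1, SetLike.GradedOne.one_mem, map_one (Ideal.Quotient.mk I.toIdeal)⟩
  mul_mem := by
    rintro i j _ _ ⟨p, hp, rfl⟩ ⟨q, hq, rfl⟩
    exact ⟨p * q, SetLike.GradedMul.mul_mem hp hq, map_mul (Ideal.Quotient.mk I.toIdeal) p q⟩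

/-- The degree `n` part of the residue class map. -/
def mkComponent (n : ℕ) : homogeneousSubmodule σ ℂ n →ₗ[ℂ] quotGrading I n :=
  (Ideal.Quotient.mkₐ ℂ I.toIdeal).toLinearMap.restrict fun _ hp => ⟨_, hp, rfl⟩

/-- The residue class map on direct sums, degree by degree. -/
def mkDirectSum :
    (DirectSum ℕ fun n => homogeneousSubmodule σ ℂ n) →ₐ[ℂ] DirectSum ℕ fun n => quotGrading I n :=
  DirectSum.toAlgebra ℂ (fun n => homogeneousSubmodule σ ℂ n)
    (fun n => (DirectSum.lof ℂ ℕ (fun n => quotGrading I n) n).comp (mkComponent I n))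
    (by
      change DirectSum.of (fun n => quotGrading I n) 0 _ = 1
      rw [DirectSum.one_def]; congr 1)
    (by
      intro i j a b
      change DirectSum.of (fun n => quotGrading I n) _ _
        = DirectSum.of (fun n => quotGrading I n) _ _ * DirectSum.of (fun n => quotGrading I n) _ _
      rw [DirectSum.of_mul_of]
      congr 1)

theorem mkDirectSum_of (n : ℕ) (p : homogeneousSubmodule σ ℂ n) :
    mkDirectSum I (DirectSum.of (fun n => homogeneousSubmodule σ ℂ n) n p)
      = DirectSum.of (fun n => quotGrading I n) n (mkComponent I n p) :=
  DirectSum.toAddMonoid_of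
    (fun n => ((DirectSum.lof ℂ ℕ (fun n => quotGrading I n) n).comp
      (mkComponent I n)).toAddMonoidHom) n p

/-- The homogeneous components of the residue class of a polynomial. -/
def preDecompose : MvPolynomial σ ℂ →ₐ[ℂ] DirectSum ℕ fun n => quotGrading I n :=
  (mkDirectSum I).comp (DirectSum.decomposeAlgEquiv (homogeneousSubmodule σ ℂ)).toAlgHom

theorem preDecompose_of_mem {n : ℕ} {p : MvPolynomial σ ℂ} (hp : p ∈ homogeneousSubmodule σ ℂ n) :
    preDecompose I p
      = DirectSum.of (fun n => quotGrading I n) n ⟨_, mk_mem_quotGrading I hp⟩ := by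
  have h : DirectSum.decompose (homogeneousSubmodule σ ℂ) p
      = DirectSum.of (fun n => homogeneousSubmodule σ ℂ n) n ⟨p, hp⟩ :=
    DirectSum.decompose_of_mem _ hp
  change mkDirectSum I (DirectSum.decompose (homogeneousSubmodule σ ℂ) p) = _
  rw [h, mkDirectSum_of]
  rfl

theorem preDecompose_eq_zero {p : MvPolynomial σ ℂ} (hp : p ∈ I.toIdeal) :
    preDecompose I p = 0 := by
  classical
  rw [← DirectSum.sum_support_decompose (homogeneousSubmodule σ ℂ) p, map_sum]
  refine Finset.sum_eq_zero fun n _ => ?_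
  rw [preDecompose_of_mem I (SetLike.coe_mem _)]
  have h : (DirectSum.decompose (homogeneousSubmodule σ ℂ) p n : MvPolynomial σ ℂ) ∈ I.toIdeal :=
    I.isHomogeneous n hp
  have h0 : (⟨_, mk_mem_quotGrading I
      (SetLike.coe_mem (DirectSum.decompose (homogeneousSubmodule σ ℂ) p n))⟩ :
      quotGrading I n) = 0 := Subtype.ext (Ideal.Quotient.eq_zero_iff_mem.mpr h)
  rw [h0, map_zero]

instance quotGrading_gradedAlgebra : GradedAlgebra (quotGrading I) :=
  GradedAlgebra.ofAlgHom _
    (Ideal.Quotient.liftₐ I.toIdeal (preDecompose I) fun _ hp => preDecompose_eq_zero I hp)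
    (by
      classical
      apply AlgHom.ext
      intro x
      obtain ⟨p, rfl⟩ := Ideal.Quotient.mk_surjective x
      change DirectSum.coeAlgHom _ (preDecompose I p) = Ideal.Quotient.mk _ p
      conv_lhs => rw [← DirectSum.sum_support_decompose (homogeneousSubmodule σ ℂ) p]
      conv_rhs => rw [← DirectSum.sum_support_decompose (homogeneousSubmodule σ ℂ) p]
      rw [map_sum, map_sum, map_sum]
      refine Finset.sum_congr rfl fun n _ => ?_
      rw [preDecompose_of_mem I (SetLike.coe_mem _)]
      exact DirectSum.coeAlgHom_of _ _ _)
    (by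
      rintro n ⟨_, p, hp, rfl⟩
      exact preDecompose_of_mem I hp)

/-- The closed subscheme of projective space defined by the homogeneous ideal `I`,
i.e. `Proj (ℂ[x_σ] / I)`. -/
def projScheme : Scheme.{0} := Proj (quotGrading I)

/-- The structure morphism to `Spec ℂ`. -/
def projStr : projScheme I ⟶ Spec (CommRingCat.of ℂ) :=
  Proj.toSpecZero (quotGrading I) ≫
    Spec.map (CommRingCat.ofHom (algebraMap ℂ (quotGrading I 0)))

/-- The residue class map as a map of graded rings. -/
def mkGraded : homogeneousSubmodule σ ℂ →+*ᵍ quotGrading I where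
  toRingHom := Ideal.Quotient.mk I.toIdeal
  map_mem := mk_mem_quotGrading I

theorem irrelevant_le_map_mkGraded :
    HomogeneousIdeal.irrelevant (quotGrading I)
      ≤ (HomogeneousIdeal.irrelevant (homogeneousSubmodule σ ℂ)).map (mkGraded I) := by
  rw [HomogeneousIdeal.irrelevant_le]
  rintro n hn _ ⟨p, hp, rfl⟩
  exact Ideal.mem_map_of_mem (mkGraded I)
    (HomogeneousIdeal.mem_irrelevant_of_mem (homogeneousSubmodule σ ℂ) hn hp)

/-- The embedding into projective space `Proj ℂ[x_σ]`. -/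
def projEmb : projScheme I ⟶ Proj (homogeneousSubmodule σ ℂ) :=
  Proj.map (mkGraded I) (irrelevant_le_map_mkGraded I)

/-- The homogeneous ideal generated by a family of homogeneous polynomials. -/
def idealOf {ι : Type} (f : ι → MvPolynomial σ ℂ) (d : ι → ℕ)
    (hf : ∀ i, (f i).IsHomogeneous (d i)) : HomogeneousIdeal (homogeneousSubmodule σ ℂ) where
  toSubmodule := Ideal.span (Set.range f)
  is_homogeneous' := Ideal.homogeneous_span _ _ (by
    rintro _ ⟨i, rfl⟩
    exact ⟨d i, hf i⟩)

end Proj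

/-! ### The three quadrics, the fourfold and the line -/

/-- The quadratic form `Q_0`. -/
def quadric₀ : MvPolynomial (Fin 8) ℂ :=
  X 0 * (X 3 + X 5 + C 2 * X 6 + C 3 * X 7) + X 1 * (-X 5 + C 5 * X 6 + C 2 * X 7)
    - X 2 * X 3 - X 2 * X 4 + X 2 * X 5 + X 3 ^ 2 - X 4 * X 6 + X 5 ^ 2 + X 6 ^ 2 + X 7 ^ 2

/-- The quadratic form `Q_1`. -/
def quadric₁ : MvPolynomial (Fin 8) ℂ :=
  X 0 * (-X 2 + C 3 * X 5 + C 7 * X 6 + C 11 * X 7)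
    + X 1 * (X 4 + C 9 * X 5 + C 4 * X 6 + X 7)
    + X 2 ^ 2 - X 2 * X 3 + C 2 * (X 3 * X 6) + X 4 ^ 2 + C 3 * (X 4 * X 7)
    + C 2 * X 5 ^ 2 + C 3 * X 6 ^ 2 + C 5 * X 7 ^ 2

/-- The quadratic form `Q_2`. -/
def quadric₂ : MvPolynomial (Fin 8) ℂ :=
  X 0 * (C 11 * X 5 + C 13 * X 6 + C 8 * X 7)
    + X 1 * (-X 3 + C 6 * X 5 + C 7 * X 6 + C 3 * X 7)
    + X 2 ^ 2 + C 5 * (X 2 * X 7) - X 3 * X 4 + C 9 * (X 3 * X 5)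
    + C 13 * X 5 ^ 2 + C 4 * X 6 ^ 2 + C 11 * X 7 ^ 2

/-- The three quadratic forms. -/
def quadric : Fin 3 → MvPolynomial (Fin 8) ℂ := ![quadric₀, quadric₁, quadric₂]

theorem isHomogeneous_quadric (i : Fin 3) : (quadric i).IsHomogeneous 2 := by
  have h1 : ∀ j : Fin 8, (X j : MvPolynomial (Fin 8) ℂ).IsHomogeneous 1 := fun j =>
    isHomogeneous_X ℂ j
  have hC : ∀ (c : ℂ) {n : ℕ} {p : MvPolynomial (Fin 8) ℂ}, p.IsHomogeneous n →
      (C c * p).IsHomogeneous n := fun c n p hp => by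
    simpa using (isHomogeneous_C (Fin 8) c).mul hp
  have hm : ∀ {p q : MvPolynomial (Fin 8) ℂ}, p.IsHomogeneous 1 → q.IsHomogeneous 1 →
      (p * q).IsHomogeneous 2 := fun hp hq => hp.mul hq
  have hs : ∀ j : Fin 8, (X j ^ 2 : MvPolynomial (Fin 8) ℂ).IsHomogeneous 2 := fun j => by
    simpa using (h1 j).pow 2
  have ha : ∀ {n : ℕ} {p q : MvPolynomial (Fin 8) ℂ}, p.IsHomogeneous n → q.IsHomogeneous n →
      (p + q).IsHomogeneous n := fun hp hq => hp.add hq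
  have hb : ∀ {n : ℕ} {p q : MvPolynomial (Fin 8) ℂ}, p.IsHomogeneous n → q.IsHomogeneous n →
      (p - q).IsHomogeneous n := fun hp hq => hp.sub hq
  have hn : ∀ {n : ℕ} {p : MvPolynomial (Fin 8) ℂ}, p.IsHomogeneous n →
      (-p).IsHomogeneous n := fun hp => hp.neg
  have h₀ : quadric₀.IsHomogeneous 2 := by
    unfold quadric₀
    with_reducible
      repeat' first | apply h1 | apply hs | apply ha | apply hb | apply hn | apply hC | apply hm
  have h₁ : quadric₁.IsHomogeneous 2 := by
    unfold quadric₁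
    with_reducible
      repeat' first | apply h1 | apply hs | apply ha | apply hb | apply hn | apply hC | apply hm
  have h₂ : quadric₂.IsHomogeneous 2 := by
    unfold quadric₂
    with_reducible
      repeat' first | apply h1 | apply hs | apply ha | apply hb | apply hn | apply hC | apply hm
  match i with
  | 0 => exact h₀
  | 1 => exact h₁
  | 2 => exact h₂

/-- The homogeneous ideal `(Q_0, Q_1, Q_2)`. -/
def idealX : HomogeneousIdeal (homogeneousSubmodule (Fin 8) ℂ) :=
  idealOf quadric (fun _ => 2) isHomogeneous_quadric

/-- The intersection `X = {Q_0 = Q_1 = Q_2 = 0}` in `ℙ⁷`. -/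
def fourfold : Scheme.{0} := projScheme idealX

/-- The structure morphism `X ⟶ Spec ℂ`. -/
def fourfoldStr : fourfold ⟶ Spec (CommRingCat.of ℂ) := projStr idealX

/-- The homogeneous ideal `(x_2, …, x_7)`. -/
def idealLine : HomogeneousIdeal (homogeneousSubmodule (Fin 8) ℂ) :=
  idealOf (fun j : Fin 6 => X (Fin.natAdd 2 j)) (fun _ => 1) fun _ => isHomogeneous_X ℂ _

/-! ### The quadric surface bundle associated with the line -/

/-- The two-dimensional subspace of `ℂ⁸` whose projectivization is the line
`x_2 = … = x_7 = 0`. -/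
def lineSpace : Submodule ℂ (Fin 8 → ℂ) where
  carrier := {v | ∀ j : Fin 6, v (Fin.natAdd 2 j) = 0}
  zero_mem' := fun _ => rfl
  add_mem' := fun {v w} hv hw j => by simp [hv j, hw j]
  smul_mem' := fun c v hv j => by simp [hv j]

/-- The projective plane spanned by the line and the point `[0 : 0 : y_0 : … : y_5]`
(for `y ≠ 0`), as a linear subspace of `ℂ⁸`. -/
def planeThrough (y : Fin 6 → ℂ) : Submodule ℂ (Fin 8 → ℂ) :=
  lineSpace ⊔ Submodule.span ℂ {![0, 0, y 0, y 1, y 2, y 3, y 4, y 5]}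

/-- The set of pairs `([λ_0 : λ_1 : λ_2], Π)`, where `Π` is a plane in `ℙ⁷` that contains the
line and is contained in the quadric `λ_0 Q_0 + λ_1 Q_1 + λ_2 Q_2 = 0`. -/
def quadricBundle : Set (ℙ ℂ (Fin 3 → ℂ) × Submodule ℂ (Fin 8 → ℂ)) :=
  {p | Module.finrank ℂ p.2 = 3 ∧ lineSpace ≤ p.2 ∧
    ∀ v ∈ p.2, ∑ i, p.1.rep i * eval v (quadric i) = 0}

/-- The fibre of the first projection over `l`, inside the space `ℙ⁵` of planes containing the
line. -/
def bundleFiber (l : ℙ ℂ (Fin 3 → ℂ)) : Set (ℙ ℂ (Fin 6 → ℂ)) :=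
  {y | (l, planeThrough y.rep) ∈ quadricBundle}

/-- `S` is the zero locus of the quadratic form `q` on the projective 3-space `ℙ(W)`. -/
def IsQuadricIn (S : Set (ℙ ℂ (Fin 6 → ℂ))) (W : Submodule ℂ (Fin 6 → ℂ))
    (q : QuadraticForm ℂ W) : Prop :=
  Module.finrank ℂ W = 4 ∧ ∀ y : ℙ ℂ (Fin 6 → ℂ), y ∈ S ↔ ∃ h : y.rep ∈ W, q ⟨y.rep, h⟩ = 0

/-- `S` is a quadric surface in a three-dimensional linear subspace of `ℙ⁵`. -/
def IsQuadricSurface (S : Set (ℙ ℂ (Fin 6 → ℂ))) : Prop :=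
  ∃ (W : Submodule ℂ (Fin 6 → ℂ)) (q : QuadraticForm ℂ W), q ≠ 0 ∧ IsQuadricIn S W q

/-- `S` is a smooth quadric surface in a three-dimensional linear subspace of `ℙ⁵`. -/
def IsSmoothQuadricSurface (S : Set (ℙ ℂ (Fin 6 → ℂ))) : Prop :=
  ∃ (W : Submodule ℂ (Fin 6 → ℂ)) (q : QuadraticForm ℂ W),
    (QuadraticMap.polarBilin q).Nondegenerate ∧ IsQuadricIn S W q

/-- The rational map `ℙ² ⇢ ℙ⁵` given by the forms `s_0, …, s_5` of equal degree, not all zero,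
is a rational section of the bundle: wherever the `s_j` do not all vanish, the plane through the
line and the point `[0 : 0 : s_0(λ) : … : s_5(λ)]` lies in the fibre over `λ`. -/
def IsRationalSection (s : Fin 6 → MvPolynomial (Fin 3) ℂ) : Prop :=
  (∃ d, ∀ j, (s j).IsHomogeneous d) ∧ s ≠ 0 ∧
    ∀ l : ℙ ℂ (Fin 3 → ℂ), (fun j => eval l.rep (s j)) ≠ 0 →
      (l, planeThrough fun j => eval l.rep (s j)) ∈ quadricBundle

end ThreeQuadrics

end

/-
A point `x ∈ X` off `ℓ` spans with `ℓ` a plane, and as `ℓ ⊂ X` the condition that the plane lies in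
`λ₀Q₀ + λ₁Q₁ + λ₂Q₂ = 0` is two linear equations in `λ`; so the plane lies in a unique member of
the net for general `x`, which makes `X` birational to `Q`. Projecting the quadrics `Q_λ` from the
point given by the rational section then makes `Q` birational to an affine space. On rings, this
says that two explicit localizations are isomorphic. Their spectrum is dense in `X` by a dimension
count: every component of the cone over `X` has dimension at least five by Krull's height theorem,
whereas the excluded part of the cone is finite over the affine space of four linear forms.

The claims that certain equations over `ℂ` have no nontrivial solution (that `X` is nonsingular,
and that the excluded part of `X` misses the common zeros of the four linear forms) are verified in
positive characteristic: a solution can be scaled to a primitive one over a valuation ring with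
residue characteristic `p`, hence reduces to a nontrivial solution modulo `p`.
-/

noncomputable section

namespace ThreeQuadrics

open scoped Matrix

attribute [local instance] MvPolynomial.gradedAlgebra

/-! ### Reduction of integral equations to positive characteristic -/

section Reduction

theorem exists_valuationSubring_charP_residueField (K : Type*) [Field K] [CharZero K]
    {p : ℕ} (hp : p.Prime) :
    ∃ V : ValuationSubring K, CharP (IsLocalRing.ResidueField V) p := by
  let A : Subring K := (Int.castRingHom K).range
  let a : A := ⟨(p : K), ⟨p, by simp⟩⟩
  have span_ne_top : Ideal.span {a} ≠ ⊤ := by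
    rw [Ne, Ideal.span_singleton_eq_top]
    intro h
    obtain ⟨⟨b, n, rfl⟩, hb⟩ := isUnit_iff_exists_inv.mp h
    have hb' : (p : K) * (n : K) = 1 := congrArg Subtype.val hb
    have hpn : (p : ℤ) * n = 1 := by exact_mod_cast hb'
    exact (Nat.prime_iff_prime_int.mp hp).not_isUnit (IsUnit.of_mul_eq_one _ hpn)
  obtain ⟨V, -, hV⟩ := Ideal.image_subset_nonunits_valuationSubring _ span_ne_top
  refine ⟨V, (CharP.charP_iff_prime_eq_zero hp).mpr ?_⟩
  obtain ⟨x, hx, hx'⟩ := V.image_maximalIdeal.symm.subset (hV ⟨a, Ideal.subset_span rfl, rfl⟩)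
  have hxp : x = (p : V) := Subtype.ext (by simpa using hx')
  rw [← map_natCast (IsLocalRing.residue V), ← hxp]
  exact Ideal.Quotient.eq_zero_iff_mem.mpr hx

theorem exists_smul_mem_valuationSubring {K ι : Type*} [Field K] [Finite ι]
    (V : ValuationSubring K) {v : ι → K} (hv : v ≠ 0) :
    ∃ (c : K) (w : ι → V), (∀ i, (w i : K) = c * v i) ∧ ∃ i, w i = 1 := by
  obtain ⟨i₀, hi₀⟩ := Function.ne_iff.mp hv
  have : Nonempty ι := ⟨i₀⟩
  obtain ⟨i, hi⟩ := Finite.exists_max fun i => V.valuation (v i)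
  have hvi : v i ≠ 0 := fun h => hi₀ (by simpa [h] using hi i₀)
  refine ⟨(v i)⁻¹, fun j => ⟨(v i)⁻¹ * v j, ?_⟩, fun j => rfl, i, ?_⟩
  · rw [← V.valuation_le_one_iff, map_mul, map_inv₀]
    exact inv_mul_le_one_of_le₀ (hi j) zero_le
  · exact Subtype.ext (inv_mul_cancel₀ hvi)

end Reduction

/-! ### The quadratic forms over an arbitrary ring -/

section Forms

variable {R S : Type*} [CommRing R] [CommRing S]

/-- The values of `Q₀, Q₁, Q₂` at a vector over any ring: the forms have integral coefficients, so
they can be reduced modulo primes. -/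
def quadVal (x : Fin 8 → R) : Fin 3 → R :=
  ![x 0 * (x 3 + x 5 + 2 * x 6 + 3 * x 7) + x 1 * (-x 5 + 5 * x 6 + 2 * x 7)
      - x 2 * x 3 - x 2 * x 4 + x 2 * x 5 + x 3 ^ 2 - x 4 * x 6 + x 5 ^ 2 + x 6 ^ 2 + x 7 ^ 2,
    x 0 * (-x 2 + 3 * x 5 + 7 * x 6 + 11 * x 7) + x 1 * (x 4 + 9 * x 5 + 4 * x 6 + x 7)
      + x 2 ^ 2 - x 2 * x 3 + 2 * (x 3 * x 6) + x 4 ^ 2 + 3 * (x 4 * x 7)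
      + 2 * x 5 ^ 2 + 3 * x 6 ^ 2 + 5 * x 7 ^ 2,
    x 0 * (11 * x 5 + 13 * x 6 + 8 * x 7) + x 1 * (-x 3 + 6 * x 5 + 7 * x 6 + 3 * x 7)
      + x 2 ^ 2 + 5 * (x 2 * x 7) - x 3 * x 4 + 9 * (x 3 * x 5)
      + 13 * x 5 ^ 2 + 4 * x 6 ^ 2 + 11 * x 7 ^ 2]

/-- The gradients of `Q₀, Q₁, Q₂` at a vector over any ring. -/
def quadGrad (x : Fin 8 → R) : Fin 3 → Fin 8 → R :=
  ![![x 3 + x 5 + 2 * x 6 + 3 * x 7,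
      -x 5 + 5 * x 6 + 2 * x 7,
      -x 3 - x 4 + x 5,
      x 0 - x 2 + 2 * x 3,
      -x 2 - x 6,
      x 0 - x 1 + x 2 + 2 * x 5,
      2 * x 0 + 5 * x 1 - x 4 + 2 * x 6,
      3 * x 0 + 2 * x 1 + 2 * x 7],
    ![-x 2 + 3 * x 5 + 7 * x 6 + 11 * x 7,
      x 4 + 9 * x 5 + 4 * x 6 + x 7,
      -x 0 + 2 * x 2 - x 3,
      -x 2 + 2 * x 6,
      x 1 + 2 * x 4 + 3 * x 7,
      3 * x 0 + 9 * x 1 + 4 * x 5,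
      7 * x 0 + 4 * x 1 + 2 * x 3 + 6 * x 6,
      11 * x 0 + x 1 + 3 * x 4 + 10 * x 7],
    ![11 * x 5 + 13 * x 6 + 8 * x 7,
      -x 3 + 6 * x 5 + 7 * x 6 + 3 * x 7,
      2 * x 2 + 5 * x 7,
      -x 1 - x 4 + 9 * x 5,
      -x 3,
      11 * x 0 + 6 * x 1 + 9 * x 3 + 26 * x 5,
      13 * x 0 + 7 * x 1 + 8 * x 6,
      8 * x 0 + 3 * x 1 + 5 * x 2 + 22 * x 7]]

theorem map_quadVal {F : Type*} [FunLike F R S] [RingHomClass F R S] (f : F)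
    (x : Fin 8 → R) (i : Fin 3) :
    f (quadVal x i) = quadVal (fun j => f (x j)) i := by
  fin_cases i <;> simp [quadVal, map_ofNat]

theorem map_quadGrad {F : Type*} [FunLike F R S] [RingHomClass F R S] (f : F)
    (x : Fin 8 → R) (i : Fin 3) (j : Fin 8) :
    f (quadGrad x i j) = quadGrad (fun j => f (x j)) i j := by
  revert i j
  simp [quadGrad, map_ofNat, Fin.forall_fin_succ]

theorem quadVal_smul (c : R) (x : Fin 8 → R) (i : Fin 3) :
    quadVal (c • x) i = c ^ 2 * quadVal x i := by
  fin_cases i <;> simp [quadVal] <;> ring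

theorem dotProduct_quadGrad_comm (x y : Fin 8 → R) (i : Fin 3) :
    x ⬝ᵥ quadGrad y i = y ⬝ᵥ quadGrad x i := by
  fin_cases i <;> simp [quadGrad, dotProduct, Fin.sum_univ_eight] <;> ring

theorem quadGrad_apply (x : Fin 8 → R) (i : Fin 3) (j : Fin 8) :
    quadGrad x i j = x ⬝ᵥ quadGrad (Pi.single j 1) i := by
  rw [dotProduct_quadGrad_comm, single_one_dotProduct]

theorem dotProduct_quadGrad_self (x : Fin 8 → R) (i : Fin 3) :
    x ⬝ᵥ quadGrad x i = 2 * quadVal x i := by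
  fin_cases i <;> simp [quadGrad, quadVal, dotProduct, Fin.sum_univ_eight] <;> ring

theorem aeval_quadric [Algebra ℂ R] (x : Fin 8 → R) (i : Fin 3) :
    aeval x (quadric i) = quadVal x i := by
  fin_cases i <;> simp [quadric, quadVal, quadric₀, quadric₁, quadric₂, map_ofNat]

theorem eval_quadric (x : Fin 8 → ℂ) (i : Fin 3) : eval x (quadric i) = quadVal x i := by
  rw [← aeval_quadric, MvPolynomial.aeval_eq_eval]

set_option maxHeartbeats 400000 in
theorem pderiv_quadric (i : Fin 3) (j : Fin 8) :
    pderiv j (quadric i) = quadGrad (X : Fin 8 → MvPolynomial (Fin 8) ℂ) i j := by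
  fin_cases i <;>
    simp only [quadric, quadric₀, quadric₁, quadric₂, quadGrad, Fin.zero_eta, Fin.mk_one,
      Fin.reduceFinMk, Matrix.cons_val, map_add, map_sub, map_neg, pderiv_C, pow_two, pderiv_X,
      Pi.single_apply, Derivation.leibniz, smul_eq_mul] <;>
    fin_cases j <;>
    simp only [Fin.zero_eta, Fin.mk_one, Fin.reduceFinMk, Fin.reduceEq, Fin.isValue,
      Matrix.cons_val, reduceIte, map_ofNat] <;>
    ring

/-- The Hessian matrix of the quadric `l₀Q₀ + l₁Q₁ + l₂Q₂`: its quadratic form is twice that of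
the quadric. -/
def netMatrix (l : Fin 3 → R) : Matrix (Fin 8) (Fin 8) R :=
  Matrix.of fun j => ∑ i, l i • quadGrad (Pi.single j 1) i

theorem netMatrix_mulVec (l : Fin 3 → R) (x : Fin 8 → R) :
    netMatrix l *ᵥ x = ∑ i, l i • quadGrad x i := by
  ext j
  change (∑ i, l i • quadGrad (Pi.single j 1) i) ⬝ᵥ x = _
  simp [sum_dotProduct, quadGrad_apply x, dotProduct_comm x]

theorem isSymm_netMatrix (l : Fin 3 → R) : (netMatrix l).IsSymm :=
  Matrix.IsSymm.ext fun j k => by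
    simp [netMatrix, quadGrad_apply (Pi.single j (1 : R))]

theorem dotProduct_netMatrix_mulVec (l : Fin 3 → R) (x : Fin 8 → R) :
    x ⬝ᵥ netMatrix l *ᵥ x = 2 * ∑ i, l i * quadVal x i := by
  simp only [netMatrix_mulVec, dotProduct_sum, dotProduct_smul, dotProduct_quadGrad_self,
    Finset.mul_sum, smul_eq_mul, mul_left_comm]

theorem map_netMatrix (f : R →+* S) (l : Fin 3 → R) :
    (netMatrix l).map f = netMatrix fun i => f (l i) := by
  have map_single (k : Fin 8) : (fun j => f ((Pi.single k 1 : Fin 8 → R) j)) = Pi.single k 1 := by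
    ext j
    simp [Pi.single_apply, apply_ite f]
  ext j k
  simp [netMatrix, map_quadGrad, map_single]

theorem netMatrix_smul (c : R) (l : Fin 3 → R) : netMatrix (c • l) = c • netMatrix l := by
  ext j k
  simp [netMatrix, Finset.mul_sum, mul_assoc]

end Forms

/-! ### Derivatives of determinants of singular symmetric matrices -/

section Adjugate

variable {m n k : Type*} [Fintype m]

theorem isSymm_transpose_mul_mul [CommRing k] {A : Matrix m m k} (hA : A.IsSymm)
    (P : Matrix m n k) : (Pᵀ * A * P).IsSymm := by
  rw [Matrix.IsSymm, Matrix.transpose_mul, Matrix.transpose_mul, Matrix.transpose_transpose,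
    hA.eq, Matrix.mul_assoc]

variable [Fintype n] [DecidableEq n]

theorem adjugate_mul_apply_comm [CommRing k] {g : Matrix n n k} {w : n → k}
    (hw : g *ᵥ w = 0) (a b c : n) : g.adjugate a b * w c = g.adjugate c b * w a := by
  let g' := g.updateRow b (Pi.single c 1)
  have g'_mulVec : g' *ᵥ w = Pi.single b (w c) := by
    ext i
    by_cases hi : i = b
    · subst hi
      simp [g', Matrix.mulVec]
    · simpa [g', Matrix.mulVec, hi] using congrFun hw i
  have adjugate_g' : g'.adjugate a b = g.adjugate a b := by
    rw [Matrix.adjugate_apply, Matrix.adjugate_apply, Matrix.updateRow_idem]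
  have h := congrFun (congrArg (g'.adjugate *ᵥ ·) g'_mulVec) a
  simp only [Matrix.mulVec_mulVec, Matrix.adjugate_mul, Matrix.smul_mulVec, Matrix.one_mulVec,
    Pi.smul_apply, smul_eq_mul, Matrix.mulVec_single, Matrix.col_apply,
    MulOpposite.smul_eq_mul_unop, MulOpposite.unop_op, adjugate_g'] at h
  rw [← h, Matrix.adjugate_apply]

theorem exists_adjugate_eq_smul_vecMulVec [Field k] {g : Matrix n n k} {w : n → k}
    (hg : g.IsSymm) (hw : g *ᵥ w = 0) (hw0 : w ≠ 0) :
    ∃ c : k, g.adjugate = c • Matrix.vecMulVec w w := by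
  obtain ⟨c, hc⟩ := Function.ne_iff.mp hw0
  replace hc : w c ≠ 0 := hc
  have adjugate_symm (a b) : g.adjugate a b = g.adjugate b a :=
    congrFun (congrFun ((Matrix.adjugate_transpose g).trans (congrArg _ hg.eq)) b) a
  refine ⟨g.adjugate c c / w c ^ 2, Matrix.ext fun a b => ?_⟩
  have hab := adjugate_mul_apply_comm hw a b c
  have hbc := adjugate_mul_apply_comm hw b c c
  rw [adjugate_symm c b] at hab
  simp only [Matrix.smul_apply, Matrix.vecMulVec_apply, smul_eq_mul]
  field_simp
  linear_combination w c * hab + w a * hbc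

variable [Field k] {A B : Matrix m m k} {P : Matrix m n k} {w : n → k}

theorem det_transpose_mul_mul_eq_zero (hw : w ≠ 0) (hA : A *ᵥ (P *ᵥ w) = 0) :
    (Pᵀ * A * P).det = 0 :=
  Matrix.exists_mulVec_eq_zero_iff.mp ⟨w, hw, by
    simp only [← Matrix.mulVec_mulVec, hA, Matrix.mulVec_zero]⟩

/-- By Jacobi's formula the trace is the derivative of `det (Pᵀ * A * P)` in the direction
`Pᵀ * B * P`. -/
theorem trace_adjugate_mul_eq_zero (hAs : A.IsSymm) (hw : w ≠ 0) (hA : A *ᵥ (P *ᵥ w) = 0)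
    (hB : (P *ᵥ w) ⬝ᵥ B *ᵥ (P *ᵥ w) = 0) :
    ((Pᵀ * A * P).adjugate * (Pᵀ * B * P)).trace = 0 := by
  obtain ⟨c, hc⟩ := exists_adjugate_eq_smul_vecMulVec (isSymm_transpose_mul_mul hAs P)
    (by simp only [← Matrix.mulVec_mulVec, hA, Matrix.mulVec_zero]) hw
  rw [hc, Matrix.smul_mul, Matrix.vecMulVec_mul, Matrix.trace_smul, Matrix.trace_vecMulVec,
    dotProduct_comm, ← Matrix.dotProduct_mulVec]
  simp only [← Matrix.mulVec_mulVec]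
  rw [Matrix.dotProduct_mulVec, Matrix.vecMul_transpose, hB, smul_zero]

end Adjugate

/-! ### Bézout identities modulo 7 -/

section Certificates

variable {R : Type*}

/-- The symmetric matrix with the given upper triangle, read row by row. -/
def symmMatrix (a b c d e f g h i j : R) : Matrix (Fin 4) (Fin 4) R :=
  !![a, b, c, d; b, e, f, g; c, f, h, i; d, g, i, j]

theorem eq_symmMatrix {A : Matrix (Fin 4) (Fin 4) R} (hA : A.IsSymm) :
    A = symmMatrix (A 0 0) (A 0 1) (A 0 2) (A 0 3) (A 1 1) (A 1 2) (A 1 3) (A 2 2) (A 2 3)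
      (A 3 3) := by
  ext i j
  fin_cases i <;> fin_cases j <;> first | rfl | exact hA.apply _ _

variable [CommRing R]

theorem adjugate_symmMatrix (a b c d e f g h i j : R) :
    (symmMatrix a b c d e f g h i j).adjugate =
      symmMatrix
        (e * h * j - e * i ^ 2 - f ^ 2 * j + 2 * f * g * i - g ^ 2 * h)
        (-b * h * j + b * i ^ 2 + c * f * j - c * g * i - d * f * i + d * g * h)
        (b * f * j - b * g * i - c * e * j + c * g ^ 2 + d * e * i - d * f * g)
        (-b * f * i + b * g * h + c * e * i - c * f * g - d * e * h + d * f ^ 2)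
        (a * h * j - a * i ^ 2 - c ^ 2 * j + 2 * c * d * i - d ^ 2 * h)
        (-a * f * j + a * g * i + b * c * j - b * d * i - c * d * g + d ^ 2 * f)
        (a * f * i - a * g * h - b * c * i + b * d * h + c ^ 2 * g - c * d * f)
        (a * e * j - a * g ^ 2 - b ^ 2 * j + 2 * b * d * g - d ^ 2 * e)
        (-a * e * i + a * f * g + b ^ 2 * i - b * c * g - b * d * f + c * d * e)
        (a * e * h - a * f ^ 2 - b ^ 2 * h + 2 * b * c * f - c ^ 2 * e) := by
  ext p q
  rw [Matrix.adjugate_fin_succ_eq_det_submatrix]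
  fin_cases p <;> fin_cases q <;>
    simp [symmMatrix, Matrix.det_fin_three, Fin.succAbove] <;> ring

theorem det_symmMatrix (a b c d e f g h i j : R) :
    (symmMatrix a b c d e f g h i j).det =
      a * (e * h * j - e * i ^ 2 - f ^ 2 * j + 2 * f * g * i - g ^ 2 * h)
        + b * (-b * h * j + b * i ^ 2 + c * f * j - c * g * i - d * f * i + d * g * h)
        + c * (b * f * j - b * g * i - c * e * j + c * g ^ 2 + d * e * i - d * f * g)
        + d * (-b * f * i + b * g * h + c * e * i - c * f * g - d * e * h + d * f ^ 2) := by
  rw [Matrix.det_eq_sum_mul_adjugate_row _ 0, adjugate_symmMatrix]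
  simp [symmMatrix, Fin.sum_univ_four]

theorem trace_symmMatrix_mul_symmMatrix (a b c d e f g h i j a' b' c' d' e' f' g' h' i' j' : R) :
    (symmMatrix a b c d e f g h i j * symmMatrix a' b' c' d' e' f' g' h' i' j').trace =
      a * a' + e * e' + h * h' + j * j'
        + 2 * (b * b' + c * c' + d * d' + f * f' + g * g' + i * i') := by
  simp [symmMatrix, Matrix.trace, Fin.sum_univ_four]
  ring

/-- The restriction of the Hessian of `sQ₀ + Q₁ + tQ₂` to the columns of `netLift s t`, modulo 7. -/
def netGram (s t : R) : Matrix (Fin 4) (Fin 4) R :=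
  symmMatrix
    0
    (-3 + 3 * t + t ^ 2 + 2 * s + s * t - 3 * s * t ^ 2 - 3 * s ^ 2 - s ^ 3)
    (2 - 3 * t - 2 * s - s * t ^ 2 - s ^ 2 + 2 * s ^ 2 * t - 2 * s ^ 3)
    (3 + t - 3 * t ^ 2 + s + s * t + s * t ^ 2 - 3 * s ^ 2 - s ^ 2 * t + 2 * s ^ 3)
    (2 - 2 * t ^ 2 - 3 * t ^ 3 + 3 * s + s * t + s * t ^ 2 - 3 * s ^ 2 - s ^ 2 * t - 2 * s ^ 3)
    (2 - t ^ 3 + 3 * s + s * t ^ 2 - 3 * s ^ 2 + 2 * s ^ 2 * t + 3 * s ^ 3)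
    (1 - t - 3 * t ^ 2 + t ^ 3 + s + 3 * s * t + 2 * s * t ^ 2 - s ^ 2 * t - s ^ 3)
    (3 + t + 2 * t ^ 2 + 2 * t ^ 3 - s - 2 * s * t - s * t ^ 2 - 2 * s ^ 2 * t - s ^ 3)
    (3 + 2 * t - t ^ 2 - 2 * t ^ 3 + 2 * s - 3 * s * t + 2 * s * t ^ 2 - 2 * s ^ 2 - 2 * s ^ 3)
    (3 - t - 3 * t ^ 2 + 2 * t ^ 3 - 2 * s - 3 * s * t ^ 2 - s ^ 2 - 2 * s ^ 2 * t - 2 * s ^ 3)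

/-- The entrywise partial derivative of `netGram s t` with respect to `s`. -/
def netGramDerivFst (s t : R) : Matrix (Fin 4) (Fin 4) R :=
  symmMatrix
    0
    (2 + t - 3 * t ^ 2 + s - 3 * s ^ 2)
    (-2 - t ^ 2 - 2 * s - 3 * s * t + s ^ 2)
    (1 + t + t ^ 2 + s - 2 * s * t - s ^ 2)
    (3 + t + t ^ 2 + s - 2 * s * t + s ^ 2)
    (3 + t ^ 2 + s - 3 * s * t + 2 * s ^ 2)
    (1 + 3 * t + 2 * t ^ 2 - 2 * s * t - 3 * s ^ 2)
    (-1 - 2 * t - t ^ 2 + 3 * s * t - 3 * s ^ 2)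
    (2 - 3 * t + 2 * t ^ 2 + 3 * s + s ^ 2)
    (-2 - 3 * t ^ 2 - 2 * s + 3 * s * t + s ^ 2)

/-- The entrywise partial derivative of `netGram s t` with respect to `t`. -/
def netGramDerivSnd (s t : R) : Matrix (Fin 4) (Fin 4) R :=
  symmMatrix
    0
    (3 + 2 * t + s + s * t)
    (-3 - 2 * s * t + 2 * s ^ 2)
    (1 + t + s + 2 * s * t - s ^ 2)
    (3 * t - 2 * t ^ 2 + s + 2 * s * t - s ^ 2)
    (-3 * t ^ 2 + 2 * s * t + 2 * s ^ 2)
    (-1 + t + 3 * t ^ 2 + 3 * s - 3 * s * t - s ^ 2)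
    (1 - 3 * t - t ^ 2 - 2 * s - 2 * s * t - 2 * s ^ 2)
    (2 - 2 * t + t ^ 2 - 3 * s - 3 * s * t)
    (-1 + t - t ^ 2 + s * t - 2 * s ^ 2)

/-- The coefficient of `det G` in the Bézout identity for `G = netGram s t`. -/
def netCoeff (s t : R) : R :=
  -2 - 2 * t ^ 3 - 3 * t ^ 5
    + s * (-1 + 2 * t + t ^ 3 + 2 * t ^ 4 + 3 * t ^ 5 - t ^ 6)
    + s ^ 2 * (3 + t + t ^ 2 - 2 * t ^ 4 - 2 * t ^ 5 - 2 * t ^ 6 - 3 * t ^ 7)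
    + s ^ 3 * (-2 + 2 * t + 2 * t ^ 2 + t ^ 3 + t ^ 4 - t ^ 5 + t ^ 6)
    + s ^ 4 * (3 - 2 * t + 3 * t ^ 2 - t ^ 4 + 2 * t ^ 5 - 3 * t ^ 6 - t ^ 7)
    + s ^ 5 * (-2 * t - 3 * t ^ 3 - t ^ 4 - t ^ 5 - 3 * t ^ 6 - t ^ 7)
    + s ^ 6 * (1 - 3 * t + 3 * t ^ 2 + 3 * t ^ 3 + t ^ 4 + t ^ 6)
    + s ^ 7 * (-2 * t ^ 4 + 2 * t ^ 5)

/-- The coefficient of `∂det G/∂s` in the Bézout identity for `G = netGram s t`. -/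
def netCoeffFst (s t : R) : R :=
  -3 + t - t ^ 2 + t ^ 3 + 3 * t ^ 4 + 2 * t ^ 5 + t ^ 6 - 2 * t ^ 7
    + s * (3 - 3 * t - t ^ 2 + 2 * t ^ 3 - t ^ 4 + t ^ 5 - t ^ 6 + 3 * t ^ 7 + 3 * t ^ 8)
    + s ^ 2 * (2 + 3 * t - 2 * t ^ 2 - 2 * t ^ 3 - t ^ 4 - t ^ 5 - 2 * t ^ 7 - 3 * t ^ 8)
    + s ^ 3 * (1 + t - 3 * t ^ 2 - 2 * t ^ 3 - t ^ 5 - 3 * t ^ 6 + t ^ 7 + 3 * t ^ 8)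
    + s ^ 4 * (2 + 2 * t - t ^ 2 - 3 * t ^ 3 + t ^ 4 + 3 * t ^ 5 - 3 * t ^ 6 + 2 * t ^ 7 - t ^ 8)
    + s ^ 5 * (-1 + 2 * t + t ^ 2 + t ^ 3 - 3 * t ^ 4 - 2 * t ^ 5 - 3 * t ^ 6 + t ^ 7)
    + s ^ 6 * (3 + 3 * t + 2 * t ^ 2 - 2 * t ^ 3 - 3 * t ^ 4 + 3 * t ^ 6 + t ^ 7)
    + s ^ 7 * (-1 + 3 * t - 3 * t ^ 2 - 3 * t ^ 3 - 3 * t ^ 4 - 3 * t ^ 5 - t ^ 6)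
    + s ^ 8 * (-t ^ 4 - 2 * t ^ 5)

/-- The coefficient of `∂det G/∂t` in the Bézout identity for `G = netGram s t`. -/
def netCoeffSnd (s t : R) : R :=
  3 + t - 3 * t ^ 2 + 2 * t ^ 3 - 2 * t ^ 4 + 3 * t ^ 5 - 3 * t ^ 6 - 2 * t ^ 7
    + s * (-2 - t ^ 2 + 3 * t ^ 3 - 3 * t ^ 4 - 2 * t ^ 5 - 2 * t ^ 6 - 3 * t ^ 7 + 3 * t ^ 8)
    + s ^ 2 * (3 + 3 * t - t ^ 2 + t ^ 3 - t ^ 4 + 3 * t ^ 5 + t ^ 7)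
    + s ^ 3 * (-1 + 2 * t + t ^ 2 + 3 * t ^ 4 - 3 * t ^ 5 - 2 * t ^ 6 + 3 * t ^ 8)
    + s ^ 4 * (-3 * t - 3 * t ^ 2 + 3 * t ^ 4 + 2 * t ^ 5 - 2 * t ^ 6 + t ^ 7)
    + s ^ 5 * (-1 - t + 2 * t ^ 2 + 3 * t ^ 3 - 3 * t ^ 5 - 3 * t ^ 6 + 3 * t ^ 7 + t ^ 8)
    + s ^ 6 * (1 - t ^ 2 - 3 * t ^ 5 - t ^ 6 - t ^ 7)
    + s ^ 7 * (-t ^ 5 - 2 * t ^ 6)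
    + s ^ 8 * (3 * t ^ 4)

set_option maxHeartbeats 4000000 in
set_option maxRecDepth 100000 in
theorem netGram_bezout [CharP R 7] (s t : R) :
    netCoeff s t * (netGram s t).det
      + netCoeffFst s t * ((netGram s t).adjugate * netGramDerivFst s t).trace
      + netCoeffSnd s t * ((netGram s t).adjugate * netGramDerivSnd s t).trace = 1 := by
  simp only [netGram, netGramDerivFst, netGramDerivSnd, adjugate_symmMatrix, det_symmMatrix,
    trace_symmMatrix_mul_symmMatrix, netCoeff, netCoeffFst, netCoeffSnd]
  grind

/-- The restriction of the Hessian of `Q₀ + tQ₂` to the columns of `pencilLift t`, modulo 7. -/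
def pencilGram (t : R) : Matrix (Fin 4) (Fin 4) R :=
  symmMatrix
    0
    (-1 - 3 * t ^ 2)
    (-2 + 2 * t - t ^ 2)
    (2 - t + t ^ 2)
    (-3 - 2 * t ^ 2 - t ^ 3 + 2 * t ^ 4 - 3 * t ^ 5)
    (2 - 2 * t - 2 * t ^ 2 + 2 * t ^ 3 - t ^ 5)
    (-1 + t + 3 * t ^ 2 - t ^ 3 - 2 * t ^ 4 + t ^ 5)
    (-1 - 2 * t - t ^ 4 + 2 * t ^ 5)
    (2 - 3 * t + 3 * t ^ 3 - 2 * t ^ 4 - 2 * t ^ 5)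
    (-1 + 3 * t + 2 * t ^ 2 + 2 * t ^ 3 - 2 * t ^ 4 + 2 * t ^ 5)

/-- The entrywise derivative of `pencilGram t`. -/
def pencilGramDeriv (t : R) : Matrix (Fin 4) (Fin 4) R :=
  symmMatrix
    0
    (t)
    (2 - 2 * t)
    (-1 + 2 * t)
    (3 * t - 3 * t ^ 2 + t ^ 3 - t ^ 4)
    (-2 + 3 * t - t ^ 2 + 2 * t ^ 4)
    (1 - t - 3 * t ^ 2 - t ^ 3 - 2 * t ^ 4)
    (-2 + 3 * t ^ 3 + 3 * t ^ 4)
    (-3 + 2 * t ^ 2 - t ^ 3 - 3 * t ^ 4)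
    (3 - 3 * t - t ^ 2 - t ^ 3 + 3 * t ^ 4)

/-- The coefficient of `det G` in the Bézout identity for `G = pencilGram t`. -/
def pencilCoeff (t : R) : R :=
  -1 + t - t ^ 2 - t ^ 4 - t ^ 5 - 3 * t ^ 6

/-- The coefficient of `d(det G)/dt` in the Bézout identity for `G = pencilGram t`. -/
def pencilCoeffDeriv (t : R) : R :=
  2 + t ^ 2 + 3 * t ^ 3 + t ^ 4 + 3 * t ^ 5 - 2 * t ^ 6 + 3 * t ^ 7

theorem pencilGram_bezout [CharP R 7] (t : R) :
    pencilCoeff t * (pencilGram t).det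
      + pencilCoeffDeriv t * ((pencilGram t).adjugate * pencilGramDeriv t).trace = 1 := by
  simp only [pencilGram, pencilGramDeriv, adjugate_symmMatrix, det_symmMatrix,
    trace_symmMatrix_mul_symmMatrix, pencilCoeff, pencilCoeffDeriv]
  grind

end Certificates

/-! ### Nonsingularity of the intersection of the quadrics -/

section Nonsingular

variable {R k : Type*} [CommRing R] [Field k]

theorem transpose_mul_netMatrix_mul_apply {n : Type*} (l : Fin 3 → R) (P : Matrix (Fin 8) n R)
    (i j : n) :
    (Pᵀ * netMatrix l * P) i j = P.col i ⬝ᵥ ∑ a, l a • quadGrad (P.col j) a := by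
  rw [Matrix.mul_assoc, ← netMatrix_mulVec]
  rfl

/-- Where rows `0, 1, 2, 4` of the Hessian of `sQ₀ + Q₁ + tQ₂` vanish, the vector is determined by
its coordinates `3, 5, 6, 7`; this is the matrix expressing it through them. -/
def netLift (s t : R) : Matrix (Fin 8) (Fin 4) R :=
  let r₂ : Fin 4 → R := ![s, s + 3 + 11 * t, 2 * s + 7 + 13 * t, 3 * s + 11 + 8 * t]
  let r₃ : Fin 4 → R := ![1, 0, 0, 0]
  let r₄ : Fin 4 → R := ![t, s - 9 - 6 * t, -5 * s - 4 - 7 * t, -2 * s - 1 - 3 * t]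
  let r₅ : Fin 4 → R := ![0, 1, 0, 0]
  let r₆ : Fin 4 → R := ![0, 0, 1, 0]
  let r₇ : Fin 4 → R := ![0, 0, 0, 1]
  Matrix.of ![s • (-r₃ - r₄ + r₅) + (2 : R) • r₂ - r₃ + (2 * t) • r₂ + (5 * t) • r₇,
    s • (r₂ + r₆) - (2 : R) • r₄ - (3 : R) • r₇ + t • r₃, r₂, r₃, r₄, r₅, r₆, r₇]

theorem netLift_mulVec {s t : R} {x : Fin 8 → R} (hx : netMatrix ![s, 1, t] *ᵥ x = 0) :
    netLift s t *ᵥ ![x 3, x 5, x 6, x 7] = x := by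
  have row (j) := congrFun hx j
  have row₀ := row 0
  have row₁ := row 1
  have row₂ := row 2
  have row₄ := row 4
  simp only [netMatrix_mulVec, Fin.sum_univ_three, quadGrad, Matrix.cons_val, Pi.add_apply,
    Pi.smul_apply, Pi.zero_apply, smul_eq_mul] at row₀ row₁ row₂ row₄
  ext j
  fin_cases j <;>
    simp only [netLift, Matrix.mulVec, dotProduct, Fin.sum_univ_four, Matrix.of_apply,
      Matrix.cons_val, Pi.add_apply, Pi.sub_apply, Pi.neg_apply, Pi.smul_apply, smul_eq_mul,
      Fin.zero_eta, Fin.mk_one, Fin.reduceFinMk, Fin.isValue]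
  · linear_combination row₂ + s * row₁ + (2 + 2 * t) * row₀
  · linear_combination -row₄ + s * row₀ + 2 * row₁
  · linear_combination row₀
  · ring
  · linear_combination -row₁
  all_goals ring

theorem netLift_gram [CharP R 7] (s t : R) :
    (netLift s t)ᵀ * netMatrix ![s, 1, t] * netLift s t = netGram s t := by
  refine (eq_symmMatrix (isSymm_transpose_mul_mul (isSymm_netMatrix _) _)).trans ?_
  rw [netGram]
  congr 1 <;>
    simp only [transpose_mul_netMatrix_mul_apply, netLift, quadGrad, dotProduct,
      Fin.sum_univ_eight, Fin.sum_univ_three, Matrix.col_apply, Matrix.of_apply, Matrix.cons_val,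
      Pi.add_apply, Pi.sub_apply, Pi.neg_apply, Pi.smul_apply, Finset.sum_apply, smul_eq_mul] <;>
    grind

theorem netLift_gram_derivFst [CharP R 7] (s t : R) :
    (netLift s t)ᵀ * netMatrix ![(1 : R), 0, 0] * netLift s t = netGramDerivFst s t := by
  refine (eq_symmMatrix (isSymm_transpose_mul_mul (isSymm_netMatrix _) _)).trans ?_
  rw [netGramDerivFst]
  congr 1 <;>
    simp only [transpose_mul_netMatrix_mul_apply, netLift, quadGrad, dotProduct,
      Fin.sum_univ_eight, Fin.sum_univ_three, Matrix.col_apply, Matrix.of_apply, Matrix.cons_val,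
      Pi.add_apply, Pi.sub_apply, Pi.neg_apply, Pi.smul_apply, Finset.sum_apply, smul_eq_mul] <;>
    grind

theorem netLift_gram_derivSnd [CharP R 7] (s t : R) :
    (netLift s t)ᵀ * netMatrix ![(0 : R), 0, 1] * netLift s t = netGramDerivSnd s t := by
  refine (eq_symmMatrix (isSymm_transpose_mul_mul (isSymm_netMatrix _) _)).trans ?_
  rw [netGramDerivSnd]
  congr 1 <;>
    simp only [transpose_mul_netMatrix_mul_apply, netLift, quadGrad, dotProduct,
      Fin.sum_univ_eight, Fin.sum_univ_three, Matrix.col_apply, Matrix.of_apply, Matrix.cons_val,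
      Pi.add_apply, Pi.sub_apply, Pi.neg_apply, Pi.smul_apply, Finset.sum_apply, smul_eq_mul] <;>
    grind

theorem eq_zero_of_netMatrix_chart [CharP k 7] {s t : k} {x : Fin 8 → k}
    (hQ : ∀ i, quadVal x i = 0) (hA : netMatrix ![s, 1, t] *ᵥ x = 0) : x = 0 := by
  by_contra hx
  have isotropic (l : Fin 3 → k) : x ⬝ᵥ netMatrix l *ᵥ x = 0 := by
    simp [dotProduct_netMatrix_mulVec, hQ]
  have lift_eq := netLift_mulVec hA
  have coords_ne_zero : ![x 3, x 5, x 6, x 7] ≠ 0 := fun h => hx <| by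
    rw [← lift_eq, h, Matrix.mulVec_zero]
  rw [← lift_eq] at hA isotropic
  have det_eq := det_transpose_mul_mul_eq_zero coords_ne_zero hA
  have trace_eq (l) :=
    trace_adjugate_mul_eq_zero (isSymm_netMatrix _) coords_ne_zero hA (isotropic l)
  have trace_fst := trace_eq ![1, 0, 0]
  have trace_snd := trace_eq ![0, 0, 1]
  rw [netLift_gram] at det_eq trace_fst trace_snd
  rw [netLift_gram_derivFst] at trace_fst
  rw [netLift_gram_derivSnd] at trace_snd
  simpa [det_eq, trace_fst, trace_snd] using netGram_bezout s t

/-- Where rows `0, 2, 3, 4` of the Hessian of `Q₀ + tQ₂` vanish, the vector is determined by its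
coordinates `1, 5, 6, 7`; this is the matrix expressing it through them. -/
def pencilLift (t : R) : Matrix (Fin 8) (Fin 4) R :=
  let r₁ : Fin 4 → R := ![1, 0, 0, 0]
  let r₅ : Fin 4 → R := ![0, 1, 0, 0]
  let r₆ : Fin 4 → R := ![0, 0, 1, 0]
  let r₇ : Fin 4 → R := ![0, 0, 0, 1]
  let r₃ : Fin 4 → R := ![0, -1 - 11 * t, -2 - 13 * t, -3 - 8 * t]
  let r₂ : Fin 4 → R := -r₆ - t • r₃
  let r₄ : Fin 4 → R := r₅ - r₃ + (2 * t) • r₂ + (5 * t) • r₇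
  Matrix.of ![r₂ - (2 : R) • r₃ + t • (r₁ + r₄ - (9 : R) • r₅), r₁, r₂, r₃, r₄, r₅, r₆, r₇]

theorem pencilLift_mulVec {t : R} {x : Fin 8 → R} (hx : netMatrix ![1, 0, t] *ᵥ x = 0) :
    pencilLift t *ᵥ ![x 1, x 5, x 6, x 7] = x := by
  have row (j) := congrFun hx j
  have row₀ := row 0
  have row₂ := row 2
  have row₃ := row 3
  have row₄ := row 4
  simp only [netMatrix_mulVec, Fin.sum_univ_three, quadGrad, Matrix.cons_val, Pi.add_apply,
    Pi.smul_apply, Pi.zero_apply, smul_eq_mul] at row₀ row₂ row₃ row₄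
  ext j
  fin_cases j <;>
    simp only [pencilLift, Matrix.mulVec, dotProduct, Fin.sum_univ_four, Matrix.of_apply,
      Matrix.cons_val, Pi.add_apply, Pi.sub_apply, Pi.neg_apply, Pi.smul_apply, smul_eq_mul,
      Fin.zero_eta, Fin.mk_one, Fin.reduceFinMk, Fin.isValue]
  · linear_combination
      -row₃ + (1 + 2 * t ^ 2) * (row₄ + t * row₀) + 2 * row₀ + t * (row₂ + row₀)
  · ring
  · linear_combination row₄ + t * row₀
  · linear_combination -row₀
  · linear_combination row₂ + row₀ + 2 * t * (row₄ + t * row₀)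
  all_goals ring

theorem pencilLift_gram [CharP R 7] (t : R) :
    (pencilLift t)ᵀ * netMatrix ![1, 0, t] * pencilLift t = pencilGram t := by
  refine (eq_symmMatrix (isSymm_transpose_mul_mul (isSymm_netMatrix _) _)).trans ?_
  rw [pencilGram]
  congr 1 <;>
    simp only [transpose_mul_netMatrix_mul_apply, pencilLift, quadGrad, dotProduct,
      Fin.sum_univ_eight, Fin.sum_univ_three, Matrix.col_apply, Matrix.of_apply, Matrix.cons_val,
      Pi.add_apply, Pi.sub_apply, Pi.neg_apply, Pi.smul_apply, Finset.sum_apply, smul_eq_mul] <;>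
    grind

theorem pencilLift_gram_deriv [CharP R 7] (t : R) :
    (pencilLift t)ᵀ * netMatrix ![(0 : R), 0, 1] * pencilLift t = pencilGramDeriv t := by
  refine (eq_symmMatrix (isSymm_transpose_mul_mul (isSymm_netMatrix _) _)).trans ?_
  rw [pencilGramDeriv]
  congr 1 <;>
    simp only [transpose_mul_netMatrix_mul_apply, pencilLift, quadGrad, dotProduct,
      Fin.sum_univ_eight, Fin.sum_univ_three, Matrix.col_apply, Matrix.of_apply, Matrix.cons_val,
      Pi.add_apply, Pi.sub_apply, Pi.neg_apply, Pi.smul_apply, Finset.sum_apply, smul_eq_mul] <;>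
    grind

theorem eq_zero_of_netMatrix_pencil [CharP k 7] {t : k} {x : Fin 8 → k}
    (hQ : ∀ i, quadVal x i = 0) (hA : netMatrix ![1, 0, t] *ᵥ x = 0) : x = 0 := by
  by_contra hx
  have isotropic (l : Fin 3 → k) : x ⬝ᵥ netMatrix l *ᵥ x = 0 := by
    simp [dotProduct_netMatrix_mulVec, hQ]
  have lift_eq := pencilLift_mulVec hA
  have coords_ne_zero : ![x 1, x 5, x 6, x 7] ≠ 0 := fun h => hx <| by
    rw [← lift_eq, h, Matrix.mulVec_zero]
  rw [← lift_eq] at hA isotropic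
  have det_eq := det_transpose_mul_mul_eq_zero coords_ne_zero hA
  have trace_eq := trace_adjugate_mul_eq_zero (isSymm_netMatrix _) coords_ne_zero hA
    (isotropic ![0, 0, 1])
  rw [pencilLift_gram] at det_eq trace_eq
  rw [pencilLift_gram_deriv] at trace_eq
  simpa [det_eq, trace_eq] using pencilGram_bezout t

/-- `-18647` is the determinant of the Hessian of `Q₂`. -/
theorem eq_zero_of_quadGrad_two_eq_zero (h : (18647 : k) ≠ 0) {x : Fin 8 → k}
    (hx : quadGrad x 2 = 0) : x = 0 := by
  simp only [funext_iff, Fin.forall_fin_succ, quadGrad, Matrix.cons_val, Matrix.cons_val_zero,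
    Matrix.cons_val_succ, Fin.succ_zero_eq_one, Fin.succ_one_eq_two, Fin.reduceSucc,
    Pi.zero_apply, IsEmpty.forall_iff, and_true] at hx ⊢
  grind

theorem eq_zero_of_netMatrix_mulVec_eq_zero_of_charP_seven [CharP k 7] {l : Fin 3 → k}
    (hl : l ≠ 0) {x : Fin 8 → k} (hQ : ∀ i, quadVal x i = 0) (hA : netMatrix l *ᵥ x = 0) :
    x = 0 := by
  have mulVec_smul_eq_zero (c : k) : netMatrix (c • l) *ᵥ x = 0 := by
    rw [netMatrix_smul, Matrix.smul_mulVec, hA, smul_zero]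
  by_cases h₁ : l 1 = 0
  · by_cases h₀ : l 0 = 0
    · have h₂ : l 2 ≠ 0 := fun h₂ => hl (by ext i; fin_cases i <;> assumption)
      refine eq_zero_of_quadGrad_two_eq_zero (fun h => ?_) ?_
      · exact absurd ((CharP.cast_eq_zero_iff k 7 18647).mp (mod_cast h)) (by norm_num)
      · simpa [netMatrix_mulVec, Fin.sum_univ_three, h₀, h₁, h₂] using hA
    · refine eq_zero_of_netMatrix_pencil (t := (l 0)⁻¹ * l 2) hQ ?_
      convert mulVec_smul_eq_zero (l 0)⁻¹
      ext i
      fin_cases i <;> simp [h₀, h₁]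
  · refine eq_zero_of_netMatrix_chart (s := (l 1)⁻¹ * l 0) (t := (l 1)⁻¹ * l 2) hQ ?_
    convert mulVec_smul_eq_zero (l 1)⁻¹
    ext i
    fin_cases i <;> simp [h₁]

theorem quadVal_residue_eq_zero {V : ValuationSubring k} {c : k} {x : Fin 8 → k} {w : Fin 8 → V}
    (hw : ∀ j, (w j : k) = c * x j) (hQ : ∀ i, quadVal x i = 0) (i : Fin 3) :
    quadVal (fun j => IsLocalRing.residue V (w j)) i = 0 := by
  have hwx : (fun j => V.subtype (w j)) = c • x := funext hw
  have quadVal_w : quadVal w i = 0 := Subtype.val_injective <| by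
    change V.subtype (quadVal w i) = 0
    rw [map_quadVal, hwx, quadVal_smul, hQ, mul_zero]
  rw [← map_quadVal, quadVal_w, map_zero]

theorem netMatrix_mulVec_residue_eq_zero {V : ValuationSubring k} {c d : k} {l : Fin 3 → k}
    {m : Fin 3 → V} {x : Fin 8 → k} {w : Fin 8 → V} (hm : ∀ i, (m i : k) = c * l i)
    (hw : ∀ j, (w j : k) = d * x j) (hA : netMatrix l *ᵥ x = 0) :
    netMatrix (fun i => IsLocalRing.residue V (m i)) *ᵥ (fun j => IsLocalRing.residue V (w j)) =
      0 := by
  have hml : (fun i => V.subtype (m i)) = c • l := funext hm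
  have hwx : (fun j => V.subtype (w j)) = d • x := funext hw
  have mulVec_w : netMatrix m *ᵥ w = 0 := funext fun j => Subtype.val_injective <| by
    change V.subtype ((netMatrix m *ᵥ w) j) = 0
    rw [RingHom.map_mulVec, map_netMatrix, hml, Function.comp_def, hwx, netMatrix_smul,
      Matrix.smul_mulVec, Matrix.mulVec_smul, hA, smul_zero, smul_zero, Pi.zero_apply]
  ext j
  rw [← map_netMatrix]
  exact (RingHom.map_mulVec _ _ _ j).symm.trans (by rw [mulVec_w]; exact map_zero _)

theorem eq_zero_of_netMatrix_mulVec_eq_zero [CharZero k] {l : Fin 3 → k} (hl : l ≠ 0)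
    {x : Fin 8 → k} (hQ : ∀ i, quadVal x i = 0) (hA : netMatrix l *ᵥ x = 0) : x = 0 := by
  by_contra hx
  obtain ⟨V, _⟩ := exists_valuationSubring_charP_residueField k Nat.prime_seven
  obtain ⟨c, m, hm, i, hi⟩ := exists_smul_mem_valuationSubring V hl
  obtain ⟨d, w, hw, j, hj⟩ := exists_smul_mem_valuationSubring V hx
  have w_residue := eq_zero_of_netMatrix_mulVec_eq_zero_of_charP_seven
    (fun h => by simpa [hi] using congrFun h i) (quadVal_residue_eq_zero hw hQ)
    (netMatrix_mulVec_residue_eq_zero hm hw hA)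
  simpa [hj] using congrFun w_residue j

end Nonsingular

/-! ### Isotropic vectors and subspaces -/

section Isotropic

open Module Submodule

variable {K V W : Type*} [Field K] [AddCommGroup V] [Module K V] [AddCommGroup W] [Module K W]

theorem exists_ne_zero_quadraticForm_eq_zero [IsAlgClosed K] [NeZero (2 : K)]
    (q : QuadraticForm K V) (hV : 1 < finrank K V) : ∃ v ≠ 0, q v = 0 := by
  have : Nontrivial V := nontrivial_of_finrank_pos (R := K) (by lia)
  obtain ⟨u, hu⟩ := exists_ne (0 : V)
  obtain ⟨v, huv⟩ := exists_linearIndependent_pair_of_one_lt_finrank hV hu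
  rw [LinearIndependent.pair_iff] at huv
  by_cases hqu : q u = 0
  · exact ⟨u, hu, hqu⟩
  obtain ⟨t, ht⟩ := exists_quadratic_eq_zero hqu
    (IsAlgClosed.exists_eq_mul_self (discrim (q u) (QuadraticMap.polar q u v) (q v)))
  refine ⟨t • u + v, fun h => one_ne_zero (huv t 1 (by rwa [one_smul])).2, ?_⟩
  rw [QuadraticMap.map_add q, QuadraticMap.map_smul, QuadraticMap.polar_smul_left, ← ht]
  simp only [smul_eq_mul]
  ring

theorem le_orthogonal_of_forall_apply_self_eq_zero [NeZero (2 : K)] {B : LinearMap.BilinForm K V}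
    (hB : B.IsSymm) {L : Submodule K V} (hL : ∀ v ∈ L, B v v = 0) : L ≤ B.orthogonal L := by
  intro v hv w hw
  have hvw := hL (v + w) (L.add_mem hv hw)
  simp only [map_add, LinearMap.add_apply] at hvw
  rw [hL v hv, hL w hw, hB.eq v w, zero_add, add_zero, ← two_mul] at hvw
  exact (mul_eq_zero.mp hvw).resolve_left two_ne_zero

theorem forall_mem_sup_span_singleton_apply_self_eq_zero_iff [NeZero (2 : K)]
    {B : LinearMap.BilinForm K V} (hB : B.IsSymm) {L : Submodule K V} (hL : L ≤ B.orthogonal L)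
    (p : V) :
    (∀ v ∈ L ⊔ K ∙ p, B v v = 0) ↔ p ∈ B.orthogonal L ∧ B p p = 0 := by
  have hp : p ∈ L ⊔ K ∙ p := le_sup_right (a := L) (mem_span_singleton_self p)
  refine ⟨fun h => ⟨fun v hv => ?_, h p hp⟩, fun ⟨hpL, hpp⟩ v hv => ?_⟩
  · exact le_orthogonal_of_forall_apply_self_eq_zero hB h hp v (le_sup_left (b := K ∙ p) hv)
  · obtain ⟨x, hx, y, hy, rfl⟩ := mem_sup.mp hv
    obtain ⟨c, rfl⟩ := mem_span_singleton.mp hy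
    have hxp := hpL x hx
    have hpx := (hB.eq x p).symm.trans hxp
    simp [hL hx x hx, hxp, hpx, hpp]

theorem sup_map_comap_eq_of_le {L M : Submodule K V} {f : W →ₗ[K] V} (hLM : L ≤ M)
    (hf : IsCompl L (LinearMap.range f)) : L ⊔ (M.comap f).map f = M := by
  rw [map_comap_eq, ← sup_inf_assoc_of_le _ hLM, hf.sup_eq_top, top_inf_eq]

variable [FiniteDimensional K V]

theorem finrank_le_finrank_ker_add_one (f : Dual K V) :
    finrank K V ≤ finrank K (LinearMap.ker f) + 1 := by
  have finrank_range := finrank_le (LinearMap.range f)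
  rw [finrank_self] at finrank_range
  rw [← f.finrank_range_add_finrank_ker]
  lia

/-- The line joins an isotropic vector `u` to one in a complement of `u` inside `u⊥`. -/
theorem exists_linearIndependent_pair_quadraticForm_eq_zero [IsAlgClosed K] [NeZero (2 : K)]
    (q : QuadraticForm K V) (hV : 3 < finrank K V) :
    ∃ b : Fin 2 → V, LinearIndependent K b ∧ ∀ a, q (Fintype.linearCombination K b a) = 0 := by
  obtain ⟨u, hu, hqu⟩ := exists_ne_zero_quadraticForm_eq_zero q (by lia)
  obtain ⟨C, hC⟩ := Submodule.exists_isCompl (K ∙ u)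
  have finrank_C := finrank_add_eq_of_isCompl hC
  rw [finrank_span_singleton hu] at finrank_C
  have finrank_ker := finrank_le_finrank_ker_add_one (q.polarBilin u)
  have finrank_inf := finrank_sup_add_finrank_inf_eq C (LinearMap.ker (q.polarBilin u))
  have finrank_sup := finrank_le (C ⊔ LinearMap.ker (q.polarBilin u))
  obtain ⟨⟨w, hwC, hwu⟩, hw, hqw⟩ := exists_ne_zero_quadraticForm_eq_zero
    (q.comp (C ⊓ LinearMap.ker (q.polarBilin u)).subtype) (by lia)
  refine ⟨![u, w], LinearIndependent.pair_iff.mpr fun s t hst => ?_, fun a => ?_⟩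
  · have htw : t • w = 0 := disjoint_def.mp hC.disjoint _
      (mem_span_singleton.mpr ⟨-s, by rw [neg_smul]; exact neg_eq_of_add_eq_zero_right hst⟩)
      (C.smul_mem t hwC)
    have ht : t = 0 := (smul_eq_zero.mp htw).resolve_right fun h => hw (Subtype.ext h)
    rw [ht, zero_smul, add_zero] at hst
    exact ⟨(smul_eq_zero.mp hst).resolve_right hu, ht⟩
  · have hqw : q w = 0 := hqw
    have polar_eq : QuadraticMap.polar q u w = 0 := hwu
    simp [Fintype.linearCombination_apply, Fin.sum_univ_two, QuadraticMap.map_add q,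
      QuadraticMap.map_smul, QuadraticMap.polar_smul_left, QuadraticMap.polar_smul_right, hqu,
      hqw, polar_eq]

theorem exists_ne_zero_quadraticForm_pair_eq_zero [IsAlgClosed K] [NeZero (2 : K)]
    (q q' : QuadraticForm K V) (hV : 3 < finrank K V) : ∃ v ≠ 0, q v = 0 ∧ q' v = 0 := by
  obtain ⟨b, hb, hqb⟩ := exists_linearIndependent_pair_quadraticForm_eq_zero q hV
  obtain ⟨a, ha, hqa⟩ := exists_ne_zero_quadraticForm_eq_zero
    (q'.comp (Fintype.linearCombination K b)) (by simp)
  exact ⟨Fintype.linearCombination K b a,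
    fun h => ha (funext (Fintype.linearIndependent_iff.mp hb a h)), hqb a, hqa⟩

theorem finrank_add_finrank_comap {L M : Submodule K V} {f : W →ₗ[K] V} (hLM : L ≤ M)
    (hf : IsCompl L (LinearMap.range f)) (hfi : Function.Injective f) :
    finrank K L + finrank K (M.comap f) = finrank K M := by
  have hdisj : L ⊓ (M.comap f).map f = ⊥ :=
    (hf.disjoint.mono_right (LinearMap.map_le_range)).eq_bot
  have h := finrank_sup_add_finrank_inf_eq L ((M.comap f).map f)
  rw [sup_map_comap_eq_of_le hLM hf, hdisj, finrank_bot, add_zero,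
    ← (equivMapOfInjective f hfi _).finrank_eq] at h
  exact h.symm

/-- The form induced on `L⊥ / L` is nondegenerate. -/
theorem eq_zero_of_forall_mem_comap_orthogonal {B : LinearMap.BilinForm K V}
    (hB : B.Nondegenerate) (hBr : B.IsRefl) {L : Submodule K V} (hL : L ≤ B.orthogonal L)
    {f : W →ₗ[K] V} (hf : IsCompl L (LinearMap.range f)) (hfi : Function.Injective f) {w : W}
    (hw : f w ∈ B.orthogonal L) (h : ∀ w', f w' ∈ B.orthogonal L → B (f w') (f w) = 0) :
    w = 0 := by
  have mem_orthogonal : f w ∈ B.orthogonal (B.orthogonal L) := by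
    rw [← sup_map_comap_eq_of_le hL hf]
    intro v hv
    obtain ⟨x, hx, _, ⟨w', hw', rfl⟩, rfl⟩ := mem_sup.mp hv
    rw [map_add, LinearMap.add_apply, hw x hx, h w' hw', add_zero]
  rw [LinearMap.BilinForm.orthogonal_orthogonal hB hBr] at mem_orthogonal
  exact hfi ((disjoint_def.mp hf.disjoint _ mem_orthogonal ⟨w, rfl⟩).trans (map_zero f).symm)

end Isotropic

/-! ### The quadric surface bundle -/

section Bundle

open Module

/-- The polar form of `l₀Q₀ + l₁Q₁ + l₂Q₂`. -/
def netBilin (l : Fin 3 → ℂ) : LinearMap.BilinForm ℂ (Fin 8 → ℂ) := Matrix.toBilin' (netMatrix l)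

theorem isSymm_netBilin (l : Fin 3 → ℂ) : (netBilin l).IsSymm :=
  Matrix.isSymm_toBilin'_iff_isSymm.mpr (isSymm_netMatrix l)

theorem netBilin_self (l : Fin 3 → ℂ) (x : Fin 8 → ℂ) :
    netBilin l x x = 2 * ∑ i, l i * quadVal x i := by
  rw [netBilin, Matrix.toBilin'_apply', dotProduct_netMatrix_mulVec]

theorem netBilin_self_eq_zero_iff {l : Fin 3 → ℂ} {x : Fin 8 → ℂ} :
    netBilin l x x = 0 ↔ ∑ i, l i * quadVal x i = 0 := by
  simp [netBilin_self]

theorem netMatrix_mulVec_eq_zero_of_mem_orthogonal_top {l : Fin 3 → ℂ} {x : Fin 8 → ℂ}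
    (hx : x ∈ (netBilin l).orthogonal ⊤) : netMatrix l *ᵥ x = 0 :=
  dotProduct_eq_zero _ fun y => by
    rw [dotProduct_comm, ← Matrix.toBilin'_apply']
    exact hx y trivial

/-- The inclusion of `ℂ⁶` as the last six coordinates of `ℂ⁸`, so that `planeThrough y` is spanned
by the line and `pad y`. -/
def pad : (Fin 6 → ℂ) →ₗ[ℂ] (Fin 8 → ℂ) where
  toFun y := ![0, 0, y 0, y 1, y 2, y 3, y 4, y 5]
  map_add' y y' := by ext i; fin_cases i <;> simp
  map_smul' c y := by ext i; fin_cases i <;> simp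

theorem pad_natAdd (y : Fin 6 → ℂ) (j : Fin 6) : pad y (Fin.natAdd 2 j) = y j := by
  fin_cases j <;> rfl

theorem pad_injective : Function.Injective pad := fun y y' h => by
  ext j
  rw [← pad_natAdd y, ← pad_natAdd y', h]

theorem isCompl_lineSpace_range_pad : IsCompl lineSpace (LinearMap.range pad) := by
  refine ⟨Submodule.disjoint_def.mpr ?_, codisjoint_iff.mpr (eq_top_iff.mpr fun x _ => ?_)⟩
  · rintro _ hy ⟨y, rfl⟩
    have y_eq_zero : y = 0 := funext fun j => (pad_natAdd y j).symm.trans (hy j)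
    rw [y_eq_zero, map_zero]
  · refine Submodule.mem_sup.mpr ⟨![x 0, x 1, 0, 0, 0, 0, 0, 0], fun j => ?_, _,
      ⟨fun j => x (Fin.natAdd 2 j), rfl⟩, ?_⟩
    · fin_cases j <;> rfl
    · ext i
      fin_cases i <;> simp [pad]

theorem finrank_lineSpace : finrank ℂ lineSpace = 2 := by
  have := Submodule.finrank_add_eq_of_isCompl isCompl_lineSpace_range_pad
  rw [LinearMap.finrank_range_of_inj pad_injective, finrank_fin_fun, finrank_fin_fun] at this
  lia

theorem mem_lineSpace_iff {x : Fin 8 → ℂ} :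
    x ∈ lineSpace ↔ x 2 = 0 ∧ x 3 = 0 ∧ x 4 = 0 ∧ x 5 = 0 ∧ x 6 = 0 ∧ x 7 = 0 := by
  change (∀ j : Fin 6, x (Fin.natAdd 2 j) = 0) ↔ _
  simp [Fin.forall_fin_succ]

theorem quadVal_eq_zero_of_mem_lineSpace {x : Fin 8 → ℂ} (hx : x ∈ lineSpace) (i : Fin 3) :
    quadVal x i = 0 := by
  obtain ⟨h₂, h₃, h₄, h₅, h₆, h₇⟩ := mem_lineSpace_iff.mp hx
  fin_cases i <;> simp [quadVal, h₂, h₃, h₄, h₅, h₆, h₇]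

theorem lineSpace_le_orthogonal (l : Fin 3 → ℂ) :
    lineSpace ≤ (netBilin l).orthogonal lineSpace :=
  le_orthogonal_of_forall_apply_self_eq_zero (isSymm_netBilin l) fun x hx =>
    netBilin_self_eq_zero_iff.mpr <| Finset.sum_eq_zero fun i _ => by
      rw [quadVal_eq_zero_of_mem_lineSpace hx, mul_zero]

theorem finrank_orthogonal_lineSpace {l : Fin 3 → ℂ} (hl : l ≠ 0) :
    finrank ℂ ((netBilin l).orthogonal lineSpace) = 6 := by
  have inf_eq_bot : lineSpace ⊓ (netBilin l).orthogonal ⊤ = ⊥ :=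
    (Submodule.eq_bot_iff _).mpr fun x hx => eq_zero_of_netMatrix_mulVec_eq_zero hl
      (quadVal_eq_zero_of_mem_lineSpace hx.1)
      (netMatrix_mulVec_eq_zero_of_mem_orthogonal_top hx.2)
  have := LinearMap.BilinForm.finrank_add_finrank_orthogonal (isSymm_netBilin l).isRefl lineSpace
  rw [inf_eq_bot, finrank_bot, finrank_lineSpace, finrank_fin_fun] at this
  lia

/-- The space whose projectivization parametrizes the planes through the line that are tangent
along the line to the quadric `l₀Q₀ + l₁Q₁ + l₂Q₂ = 0`. -/
def fiberSpace (l : Fin 3 → ℂ) : Submodule ℂ (Fin 6 → ℂ) :=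
  ((netBilin l).orthogonal lineSpace).comap pad

/-- The quadratic form defining the fibre of the bundle over `l` (twice the form
`l₀Q₀ + l₁Q₁ + l₂Q₂`). -/
def fiberForm (l : Fin 3 → ℂ) : QuadraticForm ℂ (fiberSpace l) :=
  (netBilin l).toQuadraticMap.comp (pad.comp (fiberSpace l).subtype)

theorem fiberForm_apply (l : Fin 3 → ℂ) (w : fiberSpace l) :
    fiberForm l w = netBilin l (pad w) (pad w) := rfl

theorem finrank_fiberSpace {l : Fin 3 → ℂ} (hl : l ≠ 0) : finrank ℂ (fiberSpace l) = 4 := by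
  have : finrank ℂ lineSpace + finrank ℂ (fiberSpace l) = _ :=
    finrank_add_finrank_comap (lineSpace_le_orthogonal l) isCompl_lineSpace_range_pad pad_injective
  rw [finrank_lineSpace, finrank_orthogonal_lineSpace hl] at this
  lia

theorem finrank_planeThrough {y : Fin 6 → ℂ} (hy : y ≠ 0) : finrank ℂ (planeThrough y) = 3 := by
  have hpad : pad y ≠ 0 := (map_ne_zero_iff pad pad_injective).mpr hy
  have hdisj : lineSpace ⊓ ℂ ∙ pad y = ⊥ := (isCompl_lineSpace_range_pad.disjoint.mono_right
    ((Submodule.span_singleton_le_iff_mem _ _).mpr (LinearMap.mem_range_self pad y))).eq_bot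
  have := Submodule.finrank_sup_add_finrank_inf_eq lineSpace (ℂ ∙ pad y)
  rwa [hdisj, finrank_bot, add_zero, finrank_lineSpace, finrank_span_singleton hpad] at this

theorem mem_quadricBundle_iff {l : ℙ ℂ (Fin 3 → ℂ)} {y : Fin 6 → ℂ} (hy : y ≠ 0) :
    (l, planeThrough y) ∈ quadricBundle ↔
      y ∈ fiberSpace l.rep ∧ netBilin l.rep (pad y) (pad y) = 0 := by
  refine Iff.trans ?_ (forall_mem_sup_span_singleton_apply_self_eq_zero_iff
    (isSymm_netBilin l.rep) (lineSpace_le_orthogonal l.rep) (pad y))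
  simp only [netBilin_self_eq_zero_iff, ← eval_quadric]
  exact ⟨fun h => h.2.2, fun h => ⟨finrank_planeThrough hy, le_sup_left, h⟩⟩

theorem isQuadricIn_bundleFiber (l : ℙ ℂ (Fin 3 → ℂ)) :
    IsQuadricIn (bundleFiber l) (fiberSpace l.rep) (fiberForm l.rep) :=
  ⟨finrank_fiberSpace l.rep_nonzero, fun y =>
    (mem_quadricBundle_iff y.rep_nonzero).trans exists_prop.symm⟩

theorem orthogonal_lineSpace_isotropic_of_fiberForm_eq_zero {l : Fin 3 → ℂ}
    (h : fiberForm l = 0) (x : Fin 8 → ℂ) (hx : x ∈ (netBilin l).orthogonal lineSpace) :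
    netBilin l x x = 0 := by
  rw [← sup_map_comap_eq_of_le (lineSpace_le_orthogonal l) isCompl_lineSpace_range_pad] at hx
  obtain ⟨z, hz, _, ⟨y, hy, rfl⟩, rfl⟩ := Submodule.mem_sup.mp hx
  have netBilin_pad : netBilin l (pad y) (pad y) = 0 := by
    rw [← fiberForm_apply l ⟨y, hy⟩, h, zero_apply]
  exact (forall_mem_sup_span_singleton_apply_self_eq_zero_iff (isSymm_netBilin l)
    (lineSpace_le_orthogonal l) (pad y)).mpr ⟨hy, netBilin_pad⟩ _
    (Submodule.add_mem_sup hz (Submodule.mem_span_singleton_self _))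

theorem finrank_le_three_of_le_orthogonal_top {l : Fin 3 → ℂ} (hl : l ≠ 0)
    {N : Submodule ℂ (Fin 8 → ℂ)} (hN : N ≤ (netBilin l).orthogonal ⊤) : finrank ℂ N ≤ 3 := by
  by_contra! h
  obtain ⟨i, hi⟩ := Function.ne_iff.mp hl
  let q (j : Fin 3) : QuadraticForm ℂ N :=
    (netBilin (Pi.single j 1)).toQuadraticMap.comp N.subtype
  have quadVal_of_q {j : Fin 3} {v : N} (hv : q j v = 0) : quadVal (v : Fin 8 → ℂ) j = 0 := by
    simpa [Pi.single_apply] using netBilin_self_eq_zero_iff.mp hv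
  obtain ⟨v, hv, hv₁, hv₂⟩ := exists_ne_zero_quadraticForm_pair_eq_zero (q (i + 1)) (q (i + 2)) h
  have sum_eq_zero := netBilin_self_eq_zero_iff.mp (hN v.2 v trivial)
  have quadVal_eq_zero : ∀ j, quadVal (v : Fin 8 → ℂ) j = 0 := by
    have h₁ := quadVal_of_q hv₁
    have h₂ := quadVal_of_q hv₂
    fin_cases i <;> simp_all [Fin.forall_fin_succ, Fin.sum_univ_three]
  exact hv (Subtype.ext (eq_zero_of_netMatrix_mulVec_eq_zero hl quadVal_eq_zero
    (netMatrix_mulVec_eq_zero_of_mem_orthogonal_top (hN v.2))))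

/-- If the form vanished, the six-dimensional space `ℓ⊥` would be totally isotropic in `ℂ⁸`, which
forces a kernel of dimension at least four. -/
theorem fiberForm_ne_zero {l : Fin 3 → ℂ} (hl : l ≠ 0) : fiberForm l ≠ 0 := by
  intro h
  have isotropic := le_orthogonal_of_forall_apply_self_eq_zero (isSymm_netBilin l)
    (orthogonal_lineSpace_isotropic_of_fiberForm_eq_zero h)
  have finrank_le := Submodule.finrank_mono isotropic
  have finrank_add := LinearMap.BilinForm.finrank_add_finrank_orthogonal
    (isSymm_netBilin l).isRefl ((netBilin l).orthogonal lineSpace)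
  rw [finrank_orthogonal_lineSpace hl] at finrank_le finrank_add
  rw [finrank_fin_fun] at finrank_add
  have := finrank_le_three_of_le_orthogonal_top hl
    (inf_le_right (a := (netBilin l).orthogonal lineSpace))
  lia

theorem polarBilin_fiberForm_apply (l : Fin 3 → ℂ) (w w' : fiberSpace l) :
    (fiberForm l).polarBilin w w' = 2 * netBilin l (pad w) (pad w') := by
  rw [fiberForm, QuadraticMap.polarBilin_comp, LinearMap.compl₁₂_apply,
    QuadraticMap.polarBilin_apply_apply, LinearMap.BilinMap.polar_toQuadraticMap, two_mul]
  exact congrArg _ ((isSymm_netBilin l).eq _ _)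

theorem nondegenerate_fiberForm {l : Fin 3 → ℂ} (hl : (netMatrix l).det ≠ 0) :
    (fiberForm l).polarBilin.Nondegenerate := by
  have isSymm_polarBilin : (fiberForm l).polarBilin.IsSymm := ⟨fun w w' => by
    simp only [polarBilin_fiberForm_apply, RingHom.id_apply]
    exact congrArg _ ((isSymm_netBilin l).eq _ _)⟩
  rw [isSymm_polarBilin.isRefl.nondegenerate_iff_separatingRight]
  intro w hw
  refine Subtype.ext (eq_zero_of_forall_mem_comap_orthogonal
    (LinearMap.BilinForm.nondegenerate_toBilin'_iff_det_ne_zero.mpr hl)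
    (isSymm_netBilin l).isRefl (lineSpace_le_orthogonal l) isCompl_lineSpace_range_pad
    pad_injective w.2 fun y hy => ?_)
  exact (mul_eq_zero.mp ((polarBilin_fiberForm_apply l ⟨y, hy⟩ w).symm.trans
    (hw ⟨y, hy⟩))).resolve_left two_ne_zero

/-- The discriminant of the net of quadrics. -/
def netDisc : MvPolynomial (Fin 3) ℂ := (netMatrix (X : Fin 3 → MvPolynomial (Fin 3) ℂ)).det

theorem eval_netDisc (l : Fin 3 → ℂ) : eval l netDisc = (netMatrix l).det := by
  rw [netDisc, RingHom.map_det, RingHom.mapMatrix_apply, map_netMatrix]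
  simp only [eval_X]

theorem isHomogeneous_det {σ R n : Type*} [CommRing R] [Fintype n] [DecidableEq n] {d : ℕ}
    {A : Matrix n n (MvPolynomial σ R)} (hA : ∀ i j, (A i j).IsHomogeneous d) :
    A.det.IsHomogeneous (Fintype.card n * d) := by
  rw [Matrix.det_apply']
  refine IsHomogeneous.sum _ _ _ fun τ _ => ?_
  rw [← zero_add (Fintype.card n * d), ← map_intCast (C : R →+* MvPolynomial σ R)]
  refine (isHomogeneous_C _ _).mul ?_
  simpa using IsHomogeneous.prod Finset.univ _ (fun _ => d) fun i _ => hA (τ i) i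

theorem isHomogeneous_netMatrix_X (j k : Fin 8) :
    (netMatrix (X : Fin 3 → MvPolynomial (Fin 3) ℂ) j k).IsHomogeneous 1 := by
  have single_eq_C : (Pi.single j 1 : Fin 8 → MvPolynomial (Fin 3) ℂ) =
      fun a => C ((Pi.single j 1 : Fin 8 → ℂ) a) := by
    ext a
    simp [Pi.single_apply, apply_ite C]
  simp only [netMatrix, Matrix.of_apply, Finset.sum_apply, Pi.smul_apply, smul_eq_mul, single_eq_C,
    ← map_quadGrad]
  exact IsHomogeneous.sum _ _ _ fun i _ => (isHomogeneous_X ℂ i).mul (isHomogeneous_C _ _)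

theorem isHomogeneous_netDisc : netDisc.IsHomogeneous 8 :=
  isHomogeneous_det isHomogeneous_netMatrix_X

theorem netDisc_ne_zero : netDisc ≠ 0 := by
  intro h
  have det_eq_zero : (netMatrix ![0, 0, (1 : ℂ)]).det = 0 := by rw [← eval_netDisc, h, map_zero]
  obtain ⟨v, hv, hv₀⟩ := Matrix.exists_mulVec_eq_zero_iff.mpr det_eq_zero
  refine hv (eq_zero_of_quadGrad_two_eq_zero (by norm_num) ?_)
  simpa [netMatrix_mulVec, Fin.sum_univ_three] using hv₀

theorem isRationalSection_net : IsRationalSection ![X 0, X 1, X 2, 0, 0, 0] := by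
  refine ⟨⟨1, fun j => ?_⟩, fun h => X_ne_zero (R := ℂ) (0 : Fin 3) (congrFun h 0), fun l hl => ?_⟩
  · fin_cases j
    · exact isHomogeneous_X ℂ _
    · exact isHomogeneous_X ℂ _
    · exact isHomogeneous_X ℂ _
    all_goals exact isHomogeneous_zero _ _ _
  · rw [mem_quadricBundle_iff hl, netBilin_self_eq_zero_iff]
    refine ⟨fun x hx => ?_, ?_⟩
    · obtain ⟨h₂, h₃, h₄, h₅, h₆, h₇⟩ := mem_lineSpace_iff.mp hx
      simp only [netBilin, pad, Fin.isValue, LinearMap.coe_mk, AddHom.coe_mk, Matrix.cons_val_zero,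
        eval_X, Matrix.cons_val_one, Matrix.cons_val, map_zero, Matrix.toBilin'_apply', dotProduct,
        netMatrix_mulVec, quadGrad, Finset.sum_apply, Pi.smul_apply, Matrix.cons_val',
        Matrix.cons_val_fin_one, smul_eq_mul, Fin.sum_univ_three, Fin.sum_univ_eight, h₂, h₃, h₄,
        h₅, h₆, h₇]
      ring
    · simp only [quadVal, pad, Fin.isValue, LinearMap.coe_mk, AddHom.coe_mk, Matrix.cons_val_zero,
        eval_X, Matrix.cons_val_one, Matrix.cons_val, map_zero, Fin.sum_univ_three]
      ring

end Bundle

/-! ### Charts of `Proj` at elements of degree one -/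

section Chart

open HomogeneousLocalization

variable {K A : Type*} [CommRing K] [CommRing A] [Algebra K A] (𝒜 : ℕ → Submodule K A)
  [GradedAlgebra 𝒜] {f : A}

theorem mk_self_eq_one (f : A) : Ideal.Quotient.mk (Ideal.span {f - 1}) f = 1 :=
  (Ideal.Quotient.mk_eq_mk_iff_sub_mem f 1).mpr (Ideal.mem_span_singleton_self _)

theorem isUnit_mk_self (f : A) : IsUnit (Ideal.Quotient.mk (Ideal.span {f - 1}) f) := by
  rw [mk_self_eq_one]
  exact isUnit_one

/-- Dehomogenization: the map from the homogeneous localization at `f` to `A / (f - 1)`. -/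
def awayToQuotient (f : A) : Away 𝒜 f →+* A ⧸ Ideal.span {f - 1} :=
  (IsLocalization.Away.lift (S := Localization.Away f) f
    (g := Ideal.Quotient.mk (Ideal.span {f - 1})) (isUnit_mk_self f)).comp
      (algebraMap (Away 𝒜 f) (Localization.Away f))

theorem awayToQuotient_mk {d : ℕ} (hf : f ∈ 𝒜 d) (n : ℕ) (a : A) (ha : a ∈ 𝒜 (n • d)) :
    awayToQuotient 𝒜 f (Away.mk 𝒜 hf n a ha) = Ideal.Quotient.mk _ a := by
  have h : algebraMap (Away 𝒜 f) (Localization.Away f) (Away.mk 𝒜 hf n a ha)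
      * algebraMap A _ f ^ n = algebraMap A _ a := by
    rw [HomogeneousLocalization.algebraMap_apply, Away.val_mk, ← map_pow,
      Localization.mk_eq_mk']
    exact IsLocalization.mk'_spec _ a (⟨f ^ n, n, rfl⟩ : Submonoid.powers f)
  have h' := congrArg (IsLocalization.Away.lift (S := Localization.Away f) f
    (g := Ideal.Quotient.mk (Ideal.span {f - 1})) (isUnit_mk_self f)) h
  rw [map_mul, map_pow, IsLocalization.Away.lift_eq, IsLocalization.Away.lift_eq] at h'
  have h₁ : Ideal.Quotient.mk (Ideal.span {f - 1}) f ^ n = 1 := by rw [mk_self_eq_one, one_pow]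
  exact ((mul_one _).symm.trans (congrArg _ h₁.symm)).trans h'

theorem awayToQuotient_surjective (hf : f ∈ 𝒜 1) :
    Function.Surjective (awayToQuotient 𝒜 f) := by
  intro x
  obtain ⟨a, rfl⟩ := Ideal.Quotient.mk_surjective x
  change _ ∈ (awayToQuotient 𝒜 f).range
  induction a using DirectSum.Decomposition.inductionOn 𝒜 with
  | zero => rw [map_zero]; exact zero_mem _
  | @homogeneous n m =>
    exact ⟨Away.mk 𝒜 hf n m (by simp), awayToQuotient_mk 𝒜 hf n _ _⟩
  | add a b ha hb => rw [map_add]; exact add_mem ha hb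

theorem decompose_mul_succ (hf : f ∈ 𝒜 1) (b : A) (j : ℕ) :
    (DirectSum.decompose 𝒜 (f * b) (j + 1) : A) = f * DirectSum.decompose 𝒜 b j := by
  rw [add_comm]
  exact DirectSum.coe_decompose_mul_add_of_left_mem 𝒜 hf

theorem decompose_mul_zero (hf : f ∈ 𝒜 1) (b : A) :
    (DirectSum.decompose 𝒜 (f * b) 0 : A) = 0 :=
  DirectSum.coe_decompose_mul_of_left_mem_of_not_le 𝒜 hf (by omega)

theorem decompose_add_eq_neg_pow_mul {n : ℕ} {b : A} (hf : f ∈ 𝒜 1)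
    (hb : (f - 1) * b ∈ 𝒜 n) (k : ℕ) :
    (DirectSum.decompose 𝒜 b (n + k) : A) = -(f ^ k * ((f - 1) * b)) := by
  set a := (f - 1) * b with ha
  have hcomp (j : ℕ) : (DirectSum.decompose 𝒜 b j : A)
      = DirectSum.decompose 𝒜 (f * b) j - DirectSum.decompose 𝒜 a j := by
    have hsub : b = f * b - a := by rw [ha]; ring
    conv_lhs => rw [hsub, DirectSum.decompose_sub]
    rfl
  have hlow (j : ℕ) (hj : j < n) : (DirectSum.decompose 𝒜 b j : A) = 0 := by
    rw [hcomp, DirectSum.decompose_of_mem_ne 𝒜 hb hj.ne', sub_zero]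
    induction j with
    | zero => exact decompose_mul_zero 𝒜 hf b
    | succ j ih =>
      rw [decompose_mul_succ 𝒜 hf, hcomp, DirectSum.decompose_of_mem_ne 𝒜 hb (by omega),
        ih (by omega), sub_zero, mul_zero]
  induction k with
  | zero =>
    rw [add_zero, pow_zero, one_mul, hcomp, DirectSum.decompose_of_mem_same 𝒜 hb]
    cases n with
    | zero => rw [decompose_mul_zero 𝒜 hf, zero_sub]
    | succ n => rw [decompose_mul_succ 𝒜 hf, hlow n (by omega), mul_zero, zero_sub]
  | succ k ih =>
    rw [hcomp, ← add_assoc, decompose_mul_succ 𝒜 hf, ih,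
      DirectSum.decompose_of_mem_ne 𝒜 hb (by omega)]
    ring

theorem exists_pow_mul_eq_zero {n : ℕ} {b : A} (hf : f ∈ 𝒜 1) (hb : (f - 1) * b ∈ 𝒜 n) :
    ∃ k, f ^ k * ((f - 1) * b) = 0 := by
  classical
  obtain ⟨k, hk⟩ := Infinite.exists_notMem_finset
    ((DirectSum.decompose 𝒜 b).support.image fun j => j - n)
  have hzero : DirectSum.decompose 𝒜 b (n + k) = 0 := by
    by_contra h
    exact hk (Finset.mem_image.mpr ⟨n + k, DFinsupp.mem_support_iff.mpr h, by omega⟩)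
  refine ⟨k, ?_⟩
  rw [← neg_eq_zero, ← decompose_add_eq_neg_pow_mul 𝒜 hf hb, hzero, ZeroMemClass.coe_zero]

theorem awayToQuotient_injective (hf : f ∈ 𝒜 1) :
    Function.Injective (awayToQuotient 𝒜 f) := by
  rw [injective_iff_map_eq_zero]
  intro x hx
  obtain ⟨n, a, ha, rfl⟩ := Away.mk_surjective 𝒜 hf x
  rw [awayToQuotient_mk, Ideal.Quotient.eq_zero_iff_mem, Ideal.mem_span_singleton'] at hx
  obtain ⟨b, rfl⟩ := hx
  rw [smul_eq_mul, mul_one, mul_comm b] at ha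
  obtain ⟨k, hk⟩ := exists_pow_mul_eq_zero 𝒜 hf ha
  apply HomogeneousLocalization.val_injective
  rw [Away.val_mk, HomogeneousLocalization.val_zero, Localization.mk_eq_mk',
    IsLocalization.mk'_eq_zero_iff]
  exact ⟨⟨f ^ k, k, rfl⟩, by rwa [mul_comm b]⟩

/-- The chart of `Proj` at an element `f` of degree one has coordinate ring `A / (f - 1)`. -/
def awayEquivQuotient (hf : f ∈ 𝒜 1) : Away 𝒜 f ≃+* A ⧸ Ideal.span {f - 1} :=
  RingEquiv.ofBijective (awayToQuotient 𝒜 f)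
    ⟨awayToQuotient_injective 𝒜 hf, awayToQuotient_surjective 𝒜 hf⟩

theorem awayToQuotient_comp_fromZeroRingHom (f : A) :
    ((awayToQuotient 𝒜 f).comp (fromZeroRingHom 𝒜 (Submonoid.powers f))).comp
      (algebraMap K (𝒜 0)) = algebraMap K (A ⧸ Ideal.span {f - 1}) := by
  ext c
  have hval : algebraMap (Away 𝒜 f) (Localization.Away f)
      (fromZeroRingHom 𝒜 (Submonoid.powers f) (algebraMap K (𝒜 0) c))
      = algebraMap A (Localization.Away f) (algebraMap K A c) :=
    Localization.mk_one_eq_algebraMap _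
  simp only [RingHom.comp_apply, awayToQuotient, hval, IsLocalization.Away.lift_eq]
  rfl

end Chart

/-! ### The Jacobian criterion -/

section Jacobian

universe u

variable {K σ : Type u} [Field K] {ι : Type*} [Fintype ι]

theorem exists_det_submatrix_ne_zero [DecidableEq ι] [Finite σ] (M : Matrix ι σ K)
    (hM : LinearIndependent K M.row) :
    ∃ a : ι → σ, Function.Injective a ∧ (M.submatrix id a).det ≠ 0 := by
  classical
  have : Fintype σ := Fintype.ofFinite σ
  have hrank : Module.finrank K (Submodule.span K (Set.range M.col)) = Fintype.card ι := by
    rw [← Matrix.rank_eq_finrank_span_cols, hM.rank_matrix]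
  obtain ⟨κ, b, hb, hspan, hli⟩ := exists_linearIndependent' K M.col
  have : Finite κ := Finite.of_injective b hb
  have : Fintype κ := Fintype.ofFinite κ
  have hcard : Fintype.card κ = Fintype.card ι := by
    rw [← hrank, ← hspan, finrank_span_eq_card hli]
  let e : ι ≃ κ := (Fintype.equivOfCardEq hcard).symm
  refine ⟨b ∘ e, hb.comp e.injective, ?_⟩
  rw [← isUnit_iff_ne_zero, ← Matrix.isUnit_iff_isUnit_det,
    ← Matrix.linearIndependent_cols_iff_isUnit]
  exact hli.comp e e.injective

variable (v : ι → MvPolynomial σ K)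

/-- The minor of the Jacobian matrix of `v` given by the variables `a`. -/
def jacobianMinor [DecidableEq ι] (a : ι → σ) : MvPolynomial σ K :=
  Matrix.det (Matrix.of fun i j => pderiv (a i) (v j))

theorem isStandardSmooth_localization_jacobianMinor [DecidableEq ι] [Fintype σ] (a : ι → σ)
    (ha : Function.Injective a) (T : Type*) [CommRing T]
    [Algebra (MvPolynomial σ K ⧸ Ideal.span (Set.range v)) T]
    [Algebra K T] [IsScalarTower K (MvPolynomial σ K ⧸ Ideal.span (Set.range v)) T]
    [IsLocalization.Away (Ideal.Quotient.mk (Ideal.span (Set.range v)) (jacobianMinor v a)) T] :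
    Algebra.IsStandardSmoothOfRelativeDimension (Fintype.card σ - Fintype.card ι) K T := by
  classical
  let P := Algebra.PreSubmersivePresentation.naive (v := v) a ha
  have hP : P.jacobian = Ideal.Quotient.mk _ (jacobianMinor v a) := by
    rw [P.jacobian_eq_jacobiMatrix_det]
    have : P.jacobiMatrix = Matrix.of fun i j => pderiv (a i) (v j) := by
      ext1 i j
      simp [P]
    rw [this, Algebra.Generators.algebraMap_apply]
    exact (MvPolynomial.aeval_unique (Ideal.Quotient.mkₐ K (Ideal.span (Set.range v))) ▸ rfl)
  let L := Algebra.PreSubmersivePresentation.localizationAway T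
    (Ideal.Quotient.mk (Ideal.span (Set.range v)) (jacobianMinor v a))
  let S : Algebra.SubmersivePresentation K T (Unit ⊕ σ) (Unit ⊕ ι) :=
    { L.comp P with
      jacobian_isUnit := by
        have hu : IsUnit (algebraMap (MvPolynomial σ K ⧸ Ideal.span (Set.range v)) T
          (Ideal.Quotient.mk _ (jacobianMinor v a))) := IsLocalization.Away.algebraMap_isUnit _
        change IsUnit (L.comp P).jacobian
        rw [Algebra.PreSubmersivePresentation.comp_jacobian_eq_jacobian_smul_jacobian, hP,
          Algebra.smul_def, Algebra.PreSubmersivePresentation.localizationAway_jacobian]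
        exact hu.mul hu }
  refine S.isStandardSmoothOfRelativeDimension ?_
  simp only [Algebra.Presentation.dimension, Nat.card_eq_fintype_card, Fintype.card_sum,
    Fintype.card_unit]
  omega

theorem span_jacobianMinor_eq_top [IsAlgClosed K] [DecidableEq ι] [Finite σ]
    (h : ∀ x : σ → K, (∀ i, eval x (v i) = 0) →
      LinearIndependent K fun i j => eval x (pderiv j (v i))) :
    Ideal.span ((fun a => Ideal.Quotient.mk (Ideal.span (Set.range v)) (jacobianMinor v a)) ''
      {a | Function.Injective a}) = ⊤ := by
  by_contra hne
  obtain ⟨m, hm, hle⟩ := Ideal.exists_le_maximal _ hne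
  have hm' : (m.comap (Ideal.Quotient.mk (Ideal.span (Set.range v)))).IsMaximal :=
    Ideal.comap_isMaximal_of_surjective _ Ideal.Quotient.mk_surjective
  obtain ⟨x, hx⟩ := isMaximal_iff_eq_vanishingIdeal_singleton.mp hm'
  have hmem (p : MvPolynomial σ K) : Ideal.Quotient.mk _ p ∈ m ↔ eval x p = 0 := by
    rw [← Ideal.mem_comap, hx, mem_vanishingIdeal_singleton_iff]
    exact Iff.rfl
  obtain ⟨a, ha, hdet⟩ := exists_det_submatrix_ne_zero
    (Matrix.of fun i j => eval x (pderiv j (v i))) (h x fun i => by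
      have h0 : Ideal.Quotient.mk (Ideal.span (Set.range v)) (v i) = 0 :=
        Ideal.Quotient.eq_zero_iff_mem.mpr (Ideal.subset_span ⟨i, rfl⟩)
      rw [← hmem, h0]
      exact zero_mem m)
  apply hdet
  rw [← Matrix.det_transpose]
  have := (hmem _).mp (hle (Ideal.subset_span ⟨a, ha, rfl⟩))
  rw [jacobianMinor, RingHom.map_det] at this
  exact this

theorem locally_isStandardSmooth_quotient [IsAlgClosed K] [Fintype σ]
    (h : ∀ x : σ → K, (∀ i, eval x (v i) = 0) →
      LinearIndependent K fun i j => eval x (pderiv j (v i))) :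
    RingHom.Locally (RingHom.IsStandardSmoothOfRelativeDimension
      (Fintype.card σ - Fintype.card ι))
      (algebraMap K (MvPolynomial σ K ⧸ Ideal.span (Set.range v))) := by
  classical
  refine ⟨_, span_jacobianMinor_eq_top v h, ?_⟩
  rintro _ ⟨a, ha, rfl⟩
  rw [← IsScalarTower.algebraMap_eq, RingHom.isStandardSmoothOfRelativeDimension_algebraMap]
  exact isStandardSmooth_localization_jacobianMinor v a ha _

end Jacobian

/-! ### Affine charts of projective schemes -/

section AffineChart

variable {σ : Type} (I : HomogeneousIdeal (homogeneousSubmodule σ ℂ)) (i : σ)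

/-- The residue class of the coordinate `x_i` in the homogeneous coordinate ring `ℂ[x_σ] / I`. -/
abbrev coord : MvPolynomial σ ℂ ⧸ I.toIdeal := Ideal.Quotient.mk I.toIdeal (X i)

theorem coord_mem : coord I i ∈ quotGrading I 1 := mk_mem_quotGrading I (isHomogeneous_X ℂ i)

/-- The coordinate ring of the affine chart `x_i = 1` of `Proj (ℂ[x_σ] / I)`. -/
abbrev ChartRing : Type := MvPolynomial σ ℂ ⧸ I.toIdeal ⊔ Ideal.span {X i - 1}

/-- Setting `x_i = 1` and dividing by `I` can be done in either order. -/
def quotCoordEquiv :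
    ((MvPolynomial σ ℂ ⧸ I.toIdeal) ⧸ Ideal.span {coord I i - 1}) ≃ₐ[ℂ] ChartRing I i :=
  (Ideal.quotientEquivAlgOfEq ℂ (by
    rw [Ideal.map_span, Set.image_singleton, map_sub, map_one]; rfl)).trans
    (DoubleQuot.quotQuotEquivQuotSupₐ ℂ I.toIdeal (Ideal.span {X i - 1}))

theorem quotCoordEquiv_mk (p : MvPolynomial σ ℂ) :
    quotCoordEquiv I i (Ideal.Quotient.mk _ (Ideal.Quotient.mk _ p)) = Ideal.Quotient.mk _ p :=
  rfl

/-- Dehomogenization identifies the degree zero part of `(ℂ[x_σ] / I)[1 / x_i]` with the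
coordinate ring of the chart `x_i = 1`. -/
def chartEquiv : HomogeneousLocalization.Away (quotGrading I) (coord I i) ≃+* ChartRing I i :=
  (awayEquivQuotient (quotGrading I) (coord_mem I i)).trans (quotCoordEquiv I i).toRingEquiv

theorem chartEquiv_mk (n : ℕ) (p : MvPolynomial σ ℂ)
    (hp : Ideal.Quotient.mk _ p ∈ quotGrading I (n • 1)) :
    chartEquiv I i (HomogeneousLocalization.Away.mk (quotGrading I) (coord_mem I i) n _ hp)
      = Ideal.Quotient.mk _ p := by
  change quotCoordEquiv I i (awayToQuotient _ _ _) = _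
  rw [awayToQuotient_mk, quotCoordEquiv_mk]

/-- The inclusion of the open subscheme `D₊(x_i)`. -/
def coordι :
    Spec (CommRingCat.of (HomogeneousLocalization.Away (quotGrading I) (coord I i))) ⟶
      projScheme I :=
  Proj.awayι (quotGrading I) (coord I i) (coord_mem I i) one_pos

instance isOpenImmersion_coordι : IsOpenImmersion (coordι I i) :=
  inferInstanceAs (IsOpenImmersion
    (Proj.awayι (quotGrading I) (coord I i) (coord_mem I i) one_pos))

theorem coordι_comp_projStr :
    coordι I i ≫ projStr I = Spec.map (CommRingCat.ofHom
      ((HomogeneousLocalization.fromZeroRingHom (quotGrading I)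
        (Submonoid.powers (coord I i))).comp (algebraMap ℂ (quotGrading I 0)))) := by
  rw [CommRingCat.ofHom_comp, Spec.map_comp]
  exact Proj.awayι_toSpecZero_assoc _ _ _ _ _

/-- The inclusion of the affine chart `x_i = 1`. -/
def chartι : Spec (CommRingCat.of (ChartRing I i)) ⟶ projScheme I :=
  Spec.map (CommRingCat.ofHom (chartEquiv I i).toRingHom) ≫ coordι I i

instance isIso_specMap_chartEquiv :
    IsIso (Spec.map (CommRingCat.ofHom (chartEquiv I i).toRingHom)) :=
  inferInstanceAs (IsIso (Spec.map (chartEquiv I i).toCommRingCatIso.hom))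

instance isOpenImmersion_chartι : IsOpenImmersion (chartι I i) := IsOpenImmersion.comp _ _

theorem chartι_comp_projStr :
    chartι I i ≫ projStr I = Spec.map (CommRingCat.ofHom (algebraMap ℂ (ChartRing I i))) := by
  have hcomp : (chartEquiv I i).toRingHom.comp ((HomogeneousLocalization.fromZeroRingHom
      (quotGrading I) (Submonoid.powers (coord I i))).comp (algebraMap ℂ (quotGrading I 0)))
      = algebraMap ℂ (ChartRing I i) := by
    rw [← (quotCoordEquiv I i).toAlgHom.comp_algebraMap,
      ← awayToQuotient_comp_fromZeroRingHom (quotGrading I) (coord I i)]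
    rfl
  rw [chartι, Category.assoc, coordι_comp_projStr, ← Spec.map_comp, ← CommRingCat.ofHom_comp,
    hcomp]

theorem mem_span_range_X_of_isHomogeneous {R : Type*} [CommSemiring R] {n : ℕ} (hn : n ≠ 0)
    {p : MvPolynomial σ R} (hp : p.IsHomogeneous n) :
    p ∈ Ideal.span (Set.range (X : σ → MvPolynomial σ R)) := by
  rw [← Set.image_univ, mem_ideal_span_X_image]
  intro m hm
  have hdeg : m.degree = n := by
    rw [← hp (mem_support_iff.mp hm), Finsupp.degree_eq_weight_one]
    rfl
  by_contra! hm0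
  obtain rfl : m = 0 := Finsupp.ext fun j => hm0 j trivial
  exact hn (hdeg.symm.trans (map_zero _))

theorem irrelevant_le_span_coord :
    (HomogeneousIdeal.irrelevant (quotGrading I)).toIdeal
      ≤ Ideal.span (Set.range (coord I)) := by
  rw [HomogeneousIdeal.toIdeal_irrelevant_le]
  rintro n hn _ ⟨p, hp, rfl⟩
  have hmem := Ideal.mem_map_of_mem (Ideal.Quotient.mk I.toIdeal)
    (mem_span_range_X_of_isHomogeneous hn.ne' hp)
  rwa [Ideal.map_span, ← Set.range_comp] at hmem

theorem smoothOfRelativeDimension_projStr {n : ℕ}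
    (h : ∀ i, RingHom.Locally (RingHom.IsStandardSmoothOfRelativeDimension n)
      (algebraMap ℂ (ChartRing I i))) : SmoothOfRelativeDimension n (projStr I) := by
  have hP : HasRingHomProperty (@SmoothOfRelativeDimension.{0} n)
      (RingHom.Locally (RingHom.IsStandardSmoothOfRelativeDimension n)) := inferInstance
  have : IsZariskiLocalAtSource (@SmoothOfRelativeDimension.{0} n) :=
    hP.instIsZariskiLocalAtSource
  have : MorphismProperty.RespectsIso (@SmoothOfRelativeDimension.{0} n) := this.toRespects
  let 𝒰 := (Proj.affineOpenCoverOfIrrelevantLESpan (quotGrading I) (coord I) (coord_mem I)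
    (fun _ => one_pos) (irrelevant_le_span_coord I)).openCover
  refine IsZariskiLocalAtSource.of_openCover (P := @SmoothOfRelativeDimension.{0} n) 𝒰
    fun i : σ => ?_
  change SmoothOfRelativeDimension n (coordι I i ≫ projStr I)
  rw [← MorphismProperty.cancel_left_of_respectsIso (@SmoothOfRelativeDimension.{0} n)
    (Spec.map (CommRingCat.ofHom (chartEquiv I i).toRingHom)), ← Category.assoc]
  change SmoothOfRelativeDimension n (chartι I i ≫ projStr I)
  rw [chartι_comp_projStr, HasRingHomProperty.Spec_iff (P := @SmoothOfRelativeDimension.{0} n)]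
  exact h i

end AffineChart

section ProjectiveJacobian

variable {σ ι : Type}

/-- The equations `x_i = 1` and `f = 0` of the affine chart `x_i = 1`. -/
def chartEqs (f : ι → MvPolynomial σ ℂ) (i : σ) : Option ι → MvPolynomial σ ℂ
  | none => X i - 1
  | some k => f k

variable {f : ι → MvPolynomial σ ℂ} {d : ι → ℕ}

theorem idealOf_sup_span_eq_span_chartEqs (hf : ∀ k, (f k).IsHomogeneous (d k)) (i : σ) :
    (idealOf f d hf).toIdeal ⊔ Ideal.span {X i - 1} = Ideal.span (Set.range (chartEqs f i)) := by
  have hrange : Set.range (chartEqs f i) = Set.range f ∪ {X i - 1} := by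
    ext p
    simp only [Set.mem_range, Option.exists, chartEqs, Set.union_singleton, Set.mem_insert_iff,
      eq_comm]
  rw [hrange, Ideal.span_union]
  rfl

theorem sum_eval_pderiv_mul_eq_zero [Fintype σ] {p : MvPolynomial σ ℂ} {n : ℕ}
    (hp : p.IsHomogeneous n) {x : σ → ℂ} (hx : eval x p = 0) :
    ∑ j, x j * eval x (pderiv j p) = 0 := by
  have h := congrArg (eval x) hp.sum_X_mul_pderiv
  simpa only [map_sum, map_mul, eval_X, map_nsmul, hx, smul_zero] using h

/-- By Euler's identity the gradients of the `f k` at a common zero `x` are orthogonal to `x`,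
whereas the gradient of `x_i - 1` is not. -/
theorem linearIndependent_eval_pderiv_chartEqs [Finite σ]
    (hf : ∀ k, (f k).IsHomogeneous (d k)) (i : σ) {x : σ → ℂ}
    (hx : ∀ k, eval x (chartEqs f i k) = 0)
    (h : LinearIndependent ℂ fun k j => eval x (pderiv j (f k))) :
    LinearIndependent ℂ fun k j => eval x (pderiv j (chartEqs f i k)) := by
  classical
  have : Fintype σ := Fintype.ofFinite σ
  refine linearIndependent_option.mpr ⟨h, fun hspan => ?_⟩
  have hxi : x i = 1 := by simpa [chartEqs, sub_eq_zero] using hx none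
  have hle : Submodule.span ℂ (Set.range fun k j => eval x (pderiv j (f k)))
      ≤ LinearMap.ker (dotProductBilin ℂ ℂ x) := by
    rw [Submodule.span_le]
    rintro _ ⟨k, rfl⟩
    rw [SetLike.mem_coe, LinearMap.mem_ker]
    exact sum_eval_pderiv_mul_eq_zero (hf k) (hx (some k))
  have hzero := hle hspan
  simp [chartEqs, pderiv_X, dotProduct, Pi.single_apply, hxi] at hzero

theorem smoothOfRelativeDimension_projStr_idealOf [Fintype σ] [Fintype ι]
    (hf : ∀ k, (f k).IsHomogeneous (d k)) {n : ℕ} (hn : n + Fintype.card ι + 1 = Fintype.card σ)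
    (h : ∀ x : σ → ℂ, x ≠ 0 → (∀ k, eval x (f k) = 0) →
      LinearIndependent ℂ fun k j => eval x (pderiv j (f k))) :
    SmoothOfRelativeDimension n (projStr (idealOf f d hf)) := by
  classical
  obtain rfl : n = Fintype.card σ - Fintype.card (Option ι) := by
    rw [Fintype.card_option]
    omega
  refine smoothOfRelativeDimension_projStr _ fun i => ?_
  unfold ChartRing
  rw [idealOf_sup_span_eq_span_chartEqs]
  refine locally_isStandardSmooth_quotient _ fun x hx =>
    linearIndependent_eval_pderiv_chartEqs hf i hx (h x ?_ fun k => hx (some k))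
  rintro rfl
  simpa [chartEqs] using hx none

end ProjectiveJacobian

theorem linearIndependent_eval_pderiv_quadric {x : Fin 8 → ℂ} (hx : x ≠ 0)
    (hQ : ∀ i, eval x (quadric i) = 0) :
    LinearIndependent ℂ fun i j => eval x (pderiv j (quadric i)) := by
  have hgrad : (fun i j => eval x (pderiv j (quadric i))) = quadGrad x := by
    funext i j
    rw [pderiv_quadric, map_quadGrad]
    simp only [eval_X]
  simp only [eval_quadric] at hQ
  rw [hgrad, Fintype.linearIndependent_iff']
  refine LinearMap.ker_eq_bot'.mpr fun l hl => ?_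
  by_contra hl0
  refine hx (eq_zero_of_netMatrix_mulVec_eq_zero hl0 hQ ?_)
  rw [netMatrix_mulVec]
  simpa [LinearMap.lsum_apply] using hl

theorem smoothOfRelativeDimension_fourfoldStr : SmoothOfRelativeDimension 4 fourfoldStr :=
  smoothOfRelativeDimension_projStr_idealOf isHomogeneous_quadric (by decide)
    fun _ => linearIndependent_eval_pderiv_quadric

/-! ### The line -/

section Factor

variable {σ : Type} {I J : HomogeneousIdeal (homogeneousSubmodule σ ℂ)}

/-- The map of graded rings `ℂ[x_σ] / I ⟶ ℂ[x_σ] / J` for `I ≤ J`. -/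
def factorGraded (h : I.toIdeal ≤ J.toIdeal) : quotGrading I →+*ᵍ quotGrading J where
  toRingHom := Ideal.Quotient.factor h
  map_mem := by
    rintro n _ ⟨p, hp, rfl⟩
    exact mk_mem_quotGrading J hp

theorem irrelevant_le_map_factorGraded (h : I.toIdeal ≤ J.toIdeal) :
    HomogeneousIdeal.irrelevant (quotGrading J)
      ≤ (HomogeneousIdeal.irrelevant (quotGrading I)).map (factorGraded h) := by
  rw [HomogeneousIdeal.irrelevant_le]
  rintro n hn _ ⟨p, hp, rfl⟩
  exact Ideal.mem_map_of_mem (factorGraded h)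
    (HomogeneousIdeal.mem_irrelevant_of_mem (quotGrading I) hn (mk_mem_quotGrading I hp))

theorem exists_comp_projEmb_eq (h : I.toIdeal ≤ J.toIdeal) :
    ∃ j : projScheme J ⟶ projScheme I, j ≫ projEmb I = projEmb J :=
  ⟨Proj.map (factorGraded h) (irrelevant_le_map_factorGraded h),
    (Proj.map_comp (mkGraded I) (factorGraded h) (irrelevant_le_map_mkGraded I)
      (irrelevant_le_map_factorGraded h)).symm⟩

end Factor

theorem idealX_le_idealLine : idealX.toIdeal ≤ idealLine.toIdeal := by
  have hX (j : Fin 8) (hj : 2 ≤ j.val) :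
      Ideal.Quotient.mk idealLine.toIdeal (X j : MvPolynomial (Fin 8) ℂ) = 0 := by
    obtain ⟨k, rfl⟩ : ∃ k : Fin 6, Fin.natAdd 2 k = j :=
      ⟨⟨j - 2, by omega⟩, Fin.ext (Nat.add_sub_cancel' hj)⟩
    exact Ideal.Quotient.eq_zero_iff_mem.mpr (Ideal.subset_span ⟨k, rfl⟩)
  refine Ideal.span_le.mpr ?_
  rintro _ ⟨i, rfl⟩
  rw [SetLike.mem_coe, ← Ideal.Quotient.eq_zero_iff_mem]
  fin_cases i <;> simp [quadric, quadric₀, quadric₁, quadric₂, hX]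

/-! ### The parametrization by the quadric bundle -/

section Parametrization

variable {R S : Type*} [CommRing R] [CommRing S]

/-- The projection from the line `ℓ`: the coordinates `x_0`, `x_1` are replaced by zero. -/
def projTail (x : Fin 8 → R) : Fin 8 → R := ![0, 0, x 2, x 3, x 4, x 5, x 6, x 7]

/-- The parameter of the member of the net containing the plane spanned by `ℓ` and a point `x` of
the fourfold. The equations are linear in `x_0`, `x_1`, so this is the vector product of the
vectors of coefficients of `x_0` and of `x_1` in the three forms. -/
def crossVec (x : Fin 8 → R) : Fin 3 → R :=
  crossProduct (fun i => quadGrad x i 0) (fun i => quadGrad x i 1)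

/-- The polar form of the member `l` of the net, between the point `(0, 0, l, 0, 0, 0)` of the
rational section and `x`. -/
def sectionPolar (l : Fin 3 → R) (x : Fin 8 → R) : R :=
  ∑ i, l i * (quadGrad x i 2 * l 0 + quadGrad x i 3 * l 1 + quadGrad x i 4 * l 2)

/-- The form whose nonvanishing locus in the fourfold is identified with an open subset of affine
space. -/
def openForm (x : Fin 8 → R) : R :=
  x 7 * crossVec x 1 * sectionPolar (crossVec x) (projTail x)

/-- The member of the net with affine coordinates `t 0`, `t 1`. -/
def netParam (t : Fin 4 → R) : Fin 3 → R := ![t 0, 1, t 1]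

/-- The point with `(x_0, x_1, x_3, x_5, x_6, x_7) = (0, 0, s, t 2, t 3, 1)` which spans together
with `ℓ` a plane on which the member `netParam t` of the net does not involve `x_0`, `x_1`. As `s`
varies, these points form a line through the point of the rational section. -/
def liftPoint (t : Fin 4 → R) (s : R) : Fin 8 → R :=
  ![0, 0,
    t 0 * s + ((t 0 + 3 + 11 * t 1) * t 2 + (2 * t 0 + 7 + 13 * t 1) * t 3
      + (3 * t 0 + 11 + 8 * t 1)),
    s,
    t 1 * s - ((-t 0 + 9 + 6 * t 1) * t 2 + (5 * t 0 + 4 + 7 * t 1) * t 3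
      + (2 * t 0 + 1 + 3 * t 1)),
    t 2, t 3, 1]

/-- The linear coefficient of the form `netParam t` along `s ↦ liftPoint t s`. -/
def paramLin (t : Fin 4 → R) : R := sectionPolar (netParam t) (liftPoint t 0)

/-- The constant coefficient of the form `netParam t` along `s ↦ liftPoint t s`. -/
def paramConst (t : Fin 4 → R) : R := netParam t ⬝ᵥ quadVal (liftPoint t 0)

/-- The minor `crossVec · 1` at the parametrized point, cleared of denominators. -/
def paramMinor (t : Fin 4 → R) : R :=
  paramLin t ^ 2 * ((11 * t 2 + 13 * t 3 + 8) * (-t 2 + 5 * t 3 + 2))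
    - (paramLin t * (t 2 + 2 * t 3 + 3) - paramConst t)
      * (paramConst t + paramLin t * (6 * t 2 + 7 * t 3 + 3))

/-- The equation of the complement of the parameter space. -/
def paramForm (t : Fin 4 → R) : R := paramLin t * paramMinor t

/-- The point obtained from `y` by solving `Q_0 = Q_2 = 0` for `x_0`, `x_1` by Cramer's rule, given
the inverse `m` of the minor `crossVec y 1`. -/
def solvePoint (y : Fin 8 → R) (m : R) : Fin 8 → R :=
  ![(quadVal y 0 * quadGrad y 2 1 - quadVal y 2 * quadGrad y 0 1) * m,
    (quadVal y 2 * quadGrad y 0 0 - quadVal y 0 * quadGrad y 2 0) * m,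
    y 2, y 3, y 4, y 5, y 6, y 7]

/-- The point of the fourfold with parameters `t`, where `b` and `m` are the inverses of
`paramLin t` and of the minor. -/
def paramPoint (t : Fin 4 → R) (b m : R) : Fin 8 → R :=
  solvePoint (liftPoint t (-paramConst t * b)) m

/-- The parameters of a point, where `m` is the inverse of the minor `crossVec x 1`. -/
def pointParam (x : Fin 8 → R) (m : R) : Fin 4 → R :=
  ![crossVec x 0 * m, crossVec x 2 * m, x 5, x 6]

section Map

variable {F : Type*} [FunLike F R S] [RingHomClass F R S] (f : F)

theorem map_projTail (x : Fin 8 → R) :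
    (fun j => f (projTail x j)) = projTail fun j => f (x j) := by
  ext j
  fin_cases j <;> simp [projTail]

theorem map_crossVec (x : Fin 8 → R) (i : Fin 3) :
    f (crossVec x i) = crossVec (fun j => f (x j)) i := by
  fin_cases i <;> simp [crossVec, cross_apply, map_quadGrad]

theorem map_sectionPolar (l : Fin 3 → R) (x : Fin 8 → R) :
    f (sectionPolar l x) = sectionPolar (fun i => f (l i)) fun j => f (x j) := by
  simp [sectionPolar, map_quadGrad]

theorem map_openForm (x : Fin 8 → R) : f (openForm x) = openForm fun j => f (x j) := by
  simp only [openForm, map_mul, map_crossVec, map_sectionPolar, map_projTail]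

theorem map_netParam (t : Fin 4 → R) :
    (fun i => f (netParam t i)) = netParam fun i => f (t i) := by
  ext i
  fin_cases i <;> simp [netParam]

theorem map_liftPoint (t : Fin 4 → R) (s : R) :
    (fun j => f (liftPoint t s j)) = liftPoint (fun i => f (t i)) (f s) := by
  ext j
  fin_cases j <;> simp [liftPoint, map_ofNat]

theorem map_paramLin (t : Fin 4 → R) : f (paramLin t) = paramLin fun i => f (t i) := by
  simp only [paramLin, map_sectionPolar, map_liftPoint, map_zero, map_netParam]

theorem map_paramConst (t : Fin 4 → R) : f (paramConst t) = paramConst fun i => f (t i) := by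
  simp only [paramConst, dotProduct, map_sum, map_mul, map_quadVal, map_liftPoint, map_zero,
    ← map_netParam]

theorem map_paramMinor (t : Fin 4 → R) : f (paramMinor t) = paramMinor fun i => f (t i) := by
  simp [paramMinor, map_paramLin, map_paramConst, map_ofNat]

theorem map_paramForm (t : Fin 4 → R) : f (paramForm t) = paramForm fun i => f (t i) := by
  simp only [paramForm, map_mul, map_paramLin, map_paramMinor]

theorem map_solvePoint (y : Fin 8 → R) (m : R) :
    (fun j => f (solvePoint y m j)) = solvePoint (fun j => f (y j)) (f m) := by
  ext j
  fin_cases j <;> simp [solvePoint, map_quadVal, map_quadGrad]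

theorem map_paramPoint (t : Fin 4 → R) (b m : R) (j : Fin 8) :
    f (paramPoint t b m j) = paramPoint (fun i => f (t i)) (f b) (f m) j := by
  have h := congrFun (map_solvePoint f (liftPoint t (-paramConst t * b)) m) j
  rwa [map_liftPoint, map_mul, map_neg, map_paramConst] at h

theorem map_pointParam (x : Fin 8 → R) (m : R) (i : Fin 4) :
    f (pointParam x m i) = pointParam (fun j => f (x j)) (f m) i := by
  fin_cases i <;> simp [pointParam, map_crossVec]

end Map

theorem quadVal_eq_add (x : Fin 8 → R) :
    quadVal x = x 0 • (fun i => quadGrad x i 0) + x 1 • (fun i => quadGrad x i 1)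
      + quadVal (projTail x) := by
  ext i
  fin_cases i <;> simp [quadVal, quadGrad, projTail] <;> ring

theorem quadGrad_zero_projTail (x : Fin 8 → R) (i : Fin 3) :
    quadGrad (projTail x) i 0 = quadGrad x i 0 := by
  fin_cases i <;> simp [quadGrad, projTail]

theorem quadGrad_one_projTail (x : Fin 8 → R) (i : Fin 3) :
    quadGrad (projTail x) i 1 = quadGrad x i 1 := by
  fin_cases i <;> simp [quadGrad, projTail]

theorem crossVec_projTail (x : Fin 8 → R) : crossVec (projTail x) = crossVec x := by
  simp only [crossVec, quadGrad_zero_projTail, quadGrad_one_projTail]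

theorem crossVec_one (x : Fin 8 → R) :
    crossVec x 1 = quadGrad x 2 0 * quadGrad x 0 1 - quadGrad x 0 0 * quadGrad x 2 1 := by
  rw [crossVec, cross_apply]
  rfl

theorem crossVec_dotProduct_quadVal_projTail (x : Fin 8 → R) :
    crossVec x ⬝ᵥ quadVal (projTail x) = crossVec x ⬝ᵥ quadVal x := by
  have h0 : crossVec x ⬝ᵥ (fun i => quadGrad x i 0) = 0 := by
    rw [dotProduct_comm, crossVec, dot_self_cross]
  have h1 : crossVec x ⬝ᵥ (fun i => quadGrad x i 1) = 0 := by
    rw [dotProduct_comm, crossVec, dot_cross_self]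
  rw [quadVal_eq_add x, dotProduct_add, dotProduct_add, dotProduct_smul, dotProduct_smul, h0, h1,
    smul_zero, smul_zero, zero_add, zero_add]

theorem projTail_liftPoint (t : Fin 4 → R) (s : R) :
    projTail (liftPoint t s) = liftPoint t s := by
  ext j
  fin_cases j <;> rfl

theorem projTail_solvePoint (y : Fin 8 → R) (m : R) :
    projTail (solvePoint y m) = projTail y := by
  ext j
  fin_cases j <;> rfl

theorem sectionPolar_smul (c : R) (l : Fin 3 → R) (x : Fin 8 → R) :
    sectionPolar (c • l) x = c ^ 2 * sectionPolar l x := by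
  simp only [sectionPolar, Fin.sum_univ_three, Pi.smul_apply, smul_eq_mul]
  ring

theorem netParam_dotProduct_quadVal_liftPoint (t : Fin 4 → R) (s : R) :
    netParam t ⬝ᵥ quadVal (liftPoint t s) = s * paramLin t + paramConst t := by
  simp only [paramLin, paramConst, sectionPolar, netParam, liftPoint, quadVal, quadGrad,
    dotProduct, Fin.sum_univ_three, Matrix.cons_val]
  ring

theorem sectionPolar_liftPoint (t : Fin 4 → R) (s : R) :
    sectionPolar (netParam t) (liftPoint t s) = paramLin t := by
  simp only [paramLin, sectionPolar, netParam, liftPoint, quadGrad, Fin.sum_univ_three,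
    Matrix.cons_val]
  ring

theorem crossVec_liftPoint (t : Fin 4 → R) (s : R) :
    crossVec (liftPoint t s) = crossVec (liftPoint t s) 1 • netParam t := by
  ext i
  fin_cases i <;> simp [crossVec, cross_apply, netParam, liftPoint, quadGrad] <;> ring

theorem sq_mul_crossVec_liftPoint (t : Fin 4 → R) (s : R)
    (hs : s * paramLin t = -paramConst t) :
    paramLin t ^ 2 * crossVec (liftPoint t s) 1 = paramMinor t := by
  rw [paramMinor, ← neg_neg (paramConst t), ← hs]
  simp only [crossVec_one, liftPoint, quadGrad, Matrix.cons_val]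
  ring

theorem netParam_dotProduct_quadGrad_zero (t : Fin 4 → R) (s : R) :
    netParam t ⬝ᵥ (fun i => quadGrad (liftPoint t s) i 0) = 0 := by
  simp only [dotProduct, netParam, liftPoint, quadGrad, Fin.sum_univ_three, Matrix.cons_val]
  ring

theorem netParam_dotProduct_quadGrad_one (t : Fin 4 → R) (s : R) :
    netParam t ⬝ᵥ (fun i => quadGrad (liftPoint t s) i 1) = 0 := by
  simp only [dotProduct, netParam, liftPoint, quadGrad, Fin.sum_univ_three, Matrix.cons_val]
  ring

theorem crossVec_paramPoint (t : Fin 4 → R) (b m : R) :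
    crossVec (paramPoint t b m)
      = crossVec (liftPoint t (-paramConst t * b)) 1 • netParam t := by
  rw [← crossVec_liftPoint, ← crossVec_projTail, paramPoint, projTail_solvePoint,
    projTail_liftPoint]

theorem openForm_paramPoint (t : Fin 4 → R) (b m : R) :
    openForm (paramPoint t b m)
      = crossVec (liftPoint t (-paramConst t * b)) 1 ^ 3 * paramLin t := by
  have h7 : paramPoint t b m 7 = 1 := rfl
  have hnet : netParam t 1 = 1 := rfl
  rw [openForm, crossVec_paramPoint, sectionPolar_smul, paramPoint, projTail_solvePoint,
    projTail_liftPoint, sectionPolar_liftPoint, ← paramPoint, h7, Pi.smul_apply, smul_eq_mul, hnet]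
  ring

theorem quadVal_paramPoint (t : Fin 4 → R) (b m : R) (hb : paramLin t * b = 1)
    (hm : crossVec (liftPoint t (-paramConst t * b)) 1 * m = 1) (i : Fin 3) :
    quadVal (paramPoint t b m) i = 0 := by
  set y := liftPoint t (-paramConst t * b) with hy
  have hval : quadVal (paramPoint t b m)
      = paramPoint t b m 0 • (fun i => quadGrad y i 0)
        + paramPoint t b m 1 • (fun i => quadGrad y i 1) + quadVal y := by
    have htail : projTail (paramPoint t b m) = y := by
      rw [paramPoint, projTail_solvePoint, projTail_liftPoint]
    simp only [← htail, quadGrad_zero_projTail, quadGrad_one_projTail]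
    exact quadVal_eq_add _
  have hnet : netParam t ⬝ᵥ quadVal (paramPoint t b m) = 0 := by
    rw [hval, dotProduct_add, dotProduct_add, dotProduct_smul, dotProduct_smul, hy,
      netParam_dotProduct_quadGrad_zero, netParam_dotProduct_quadGrad_one,
      netParam_dotProduct_quadVal_liftPoint]
    linear_combination -paramConst t * hb
  rw [crossVec_one] at hm
  have h0 : quadVal (paramPoint t b m) 0 = 0 := by
    rw [hval]
    change (quadVal y 0 * quadGrad y 2 1 - quadVal y 2 * quadGrad y 0 1) * m * quadGrad y 0 0
      + (quadVal y 2 * quadGrad y 0 0 - quadVal y 0 * quadGrad y 2 0) * m * quadGrad y 0 1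
      + quadVal y 0 = 0
    linear_combination -quadVal y 0 * hm
  have h2 : quadVal (paramPoint t b m) 2 = 0 := by
    rw [hval]
    change (quadVal y 0 * quadGrad y 2 1 - quadVal y 2 * quadGrad y 0 1) * m * quadGrad y 2 0
      + (quadVal y 2 * quadGrad y 0 0 - quadVal y 0 * quadGrad y 2 0) * m * quadGrad y 2 1
      + quadVal y 2 = 0
    linear_combination -quadVal y 2 * hm
  match i with
  | 0 => exact h0
  | 2 => exact h2
  | 1 => simpa [dotProduct, Fin.sum_univ_three, netParam, h0, h2] using hnet

theorem pointParam_paramPoint (t : Fin 4 → R) (b m : R)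
    (hm : crossVec (liftPoint t (-paramConst t * b)) 1 * m = 1) :
    pointParam (paramPoint t b m) m = t := by
  ext i
  fin_cases i
  · change crossVec (paramPoint t b m) 0 * m = t 0
    rw [crossVec_paramPoint]
    change _ * t 0 * m = t 0
    linear_combination t 0 * hm
  · change crossVec (paramPoint t b m) 2 * m = t 1
    rw [crossVec_paramPoint]
    change _ * t 1 * m = t 1
    linear_combination t 1 * hm
  · rfl
  · rfl

section Point

variable {x : Fin 8 → R} {m : R}

theorem liftPoint_pointParam (h7 : x 7 = 1) (hm : crossVec x 1 * m = 1) :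
    liftPoint (pointParam x m) (x 3) = projTail x := by
  ext j
  fin_cases j <;>
    simp [liftPoint, pointParam, projTail, crossVec, cross_apply, quadGrad, h7] at hm ⊢
  · linear_combination -(-x 2 + 3 * x 5 + 7 * x 6 + 11) * hm
  · linear_combination (x 4 + 9 * x 5 + 4 * x 6 + 1) * hm

theorem netParam_pointParam (hm : crossVec x 1 * m = 1) :
    netParam (pointParam x m) = m • crossVec x := by
  ext i
  fin_cases i
  · exact mul_comm _ _
  · exact hm.symm.trans (mul_comm _ _)
  · exact mul_comm _ _

theorem paramLin_pointParam (h7 : x 7 = 1) (hm : crossVec x 1 * m = 1) :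
    paramLin (pointParam x m) = m ^ 2 * sectionPolar (crossVec x) (projTail x) := by
  rw [← sectionPolar_liftPoint _ (x 3), liftPoint_pointParam h7 hm, netParam_pointParam hm,
    sectionPolar_smul]

theorem mul_paramLin_pointParam (h7 : x 7 = 1) (hm : crossVec x 1 * m = 1)
    (hQ : ∀ i, quadVal x i = 0) :
    x 3 * paramLin (pointParam x m) = -paramConst (pointParam x m) := by
  have hzero : quadVal x = 0 := funext hQ
  rw [eq_neg_iff_add_eq_zero, ← netParam_dotProduct_quadVal_liftPoint,
    liftPoint_pointParam h7 hm, netParam_pointParam hm, smul_dotProduct,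
    crossVec_dotProduct_quadVal_projTail, hzero, dotProduct_zero, smul_zero]

theorem paramMinor_pointParam (h7 : x 7 = 1) (hm : crossVec x 1 * m = 1)
    (hQ : ∀ i, quadVal x i = 0) :
    paramMinor (pointParam x m) = paramLin (pointParam x m) ^ 2 * crossVec x 1 := by
  rw [← sq_mul_crossVec_liftPoint _ _ (mul_paramLin_pointParam h7 hm hQ),
    liftPoint_pointParam h7 hm, crossVec_projTail]

theorem liftPoint_pointParam_eq (h7 : x 7 = 1) (hm : crossVec x 1 * m = 1)
    (hQ : ∀ i, quadVal x i = 0) {b : R} (hb : paramLin (pointParam x m) * b = 1) :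
    liftPoint (pointParam x m) (-paramConst (pointParam x m) * b) = projTail x := by
  rw [← liftPoint_pointParam h7 hm, ← mul_paramLin_pointParam h7 hm hQ, mul_assoc, hb, mul_one]

theorem paramPoint_pointParam (h7 : x 7 = 1) (hm : crossVec x 1 * m = 1)
    (hQ : ∀ i, quadVal x i = 0) {b : R} (hb : paramLin (pointParam x m) * b = 1) :
    paramPoint (pointParam x m) b m = x := by
  have hval (i : Fin 3) : x 0 * quadGrad x i 0 + x 1 * quadGrad x i 1 + quadVal (projTail x) i
      = 0 := (congrFun (quadVal_eq_add x) i).symm.trans (hQ i)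
  rw [crossVec_one] at hm
  rw [paramPoint, liftPoint_pointParam_eq h7 (crossVec_one x ▸ hm) hQ hb]
  ext j
  fin_cases j
  · change (quadVal (projTail x) 0 * quadGrad (projTail x) 2 1
      - quadVal (projTail x) 2 * quadGrad (projTail x) 0 1) * m = x 0
    rw [quadGrad_one_projTail, quadGrad_one_projTail]
    linear_combination x 0 * hm + m * quadGrad x 2 1 * hval 0 - m * quadGrad x 0 1 * hval 2
  · change (quadVal (projTail x) 2 * quadGrad (projTail x) 0 0
      - quadVal (projTail x) 0 * quadGrad (projTail x) 2 0) * m = x 1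
    rw [quadGrad_zero_projTail, quadGrad_zero_projTail]
    linear_combination x 1 * hm + m * quadGrad x 0 0 * hval 2 - m * quadGrad x 2 0 * hval 0
  all_goals rfl

end Point

end Parametrization

/-! ### The isomorphism of coordinate rings -/

section CoordinateRings

/-- The coordinate ring of the open subset `openForm ≠ 0` of the fourfold. -/
abbrev OpenRing : Type :=
  Localization.Away (Ideal.Quotient.mk (idealX.toIdeal ⊔ Ideal.span {X 7 - 1})
    (openForm (X : Fin 8 → MvPolynomial (Fin 8) ℂ)))

/-- The coordinate ring of the open subset `paramForm ≠ 0` of affine space. -/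
abbrev ParamRing : Type :=
  Localization.Away (paramForm (X : Fin 4 → MvPolynomial (Fin 4) ℂ))

/-- The tautological point with coordinates in `OpenRing`. -/
def genericPoint (j : Fin 8) : OpenRing :=
  algebraMap (ChartRing idealX 7) OpenRing (Ideal.Quotient.mk _ (X j))

/-- The tautological parameter with coordinates in `ParamRing`. -/
def genericParam (i : Fin 4) : ParamRing := algebraMap (MvPolynomial (Fin 4) ℂ) ParamRing (X i)

theorem quadric_eq_quadVal_X (i : Fin 3) :
    quadric i = quadVal (X : Fin 8 → MvPolynomial (Fin 8) ℂ) i := by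
  rw [← aeval_quadric, aeval_X_left_apply]

theorem quadVal_genericPoint (i : Fin 3) : quadVal genericPoint i = 0 := by
  have hmem : quadric i ∈ idealX.toIdeal ⊔ Ideal.span {X 7 - 1} :=
    Ideal.mem_sup_left (Ideal.subset_span ⟨i, rfl⟩)
  rw [← Ideal.Quotient.eq_zero_iff_mem, quadric_eq_quadVal_X, map_quadVal] at hmem
  have h := congrArg (algebraMap (ChartRing idealX 7) OpenRing) hmem
  rwa [map_quadVal, map_zero] at h

theorem genericPoint_seven : genericPoint 7 = 1 := by
  have hmem : X 7 - 1 ∈ idealX.toIdeal ⊔ Ideal.span {X 7 - 1} :=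
    Ideal.mem_sup_right (Ideal.mem_span_singleton_self _)
  rw [genericPoint, (Ideal.Quotient.mk_eq_mk_iff_sub_mem _ _).mpr hmem, map_one, map_one]

theorem isUnit_openForm_genericPoint : IsUnit (openForm genericPoint) := by
  have h : IsUnit (algebraMap (ChartRing idealX 7) OpenRing (Ideal.Quotient.mk _ (openForm X))) :=
    IsLocalization.Away.algebraMap_isUnit _
  have e := map_openForm
    ((algebraMap (ChartRing idealX 7) OpenRing).comp (Ideal.Quotient.mk _)) X
  exact (congrArg IsUnit e).mp h

theorem isUnit_paramForm_genericParam : IsUnit (paramForm genericParam) := by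
  have h : IsUnit (algebraMap (MvPolynomial (Fin 4) ℂ) ParamRing (paramForm X)) :=
    IsLocalization.Away.algebraMap_isUnit _
  rwa [map_paramForm] at h

variable {T : Type*} [CommRing T] [Algebra ℂ T]

theorem exists_algHom_openRing (x : Fin 8 → T) (hQ : ∀ i, quadVal x i = 0) (h7 : x 7 = 1)
    (hu : IsUnit (openForm x)) : ∃ f : OpenRing →ₐ[ℂ] T, ∀ j, f (genericPoint j) = x j := by
  have hle : idealX.toIdeal ⊔ Ideal.span {X 7 - 1} ≤ RingHom.ker (aeval (R := ℂ) x) := by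
    refine sup_le (Ideal.span_le.mpr ?_) ((Ideal.span_singleton_le_iff_mem _).mpr ?_)
    · rintro _ ⟨i, rfl⟩
      exact (aeval_quadric x i).trans (hQ i)
    · rw [RingHom.mem_ker, map_sub, aeval_X, map_one, h7, sub_self]
  let φ : ChartRing idealX 7 →ₐ[ℂ] T := Ideal.Quotient.liftₐ _ (aeval x) hle
  have hφ (p : MvPolynomial (Fin 8) ℂ) : φ (Ideal.Quotient.mk _ p) = aeval x p := rfl
  have hφu : IsUnit (φ (Ideal.Quotient.mk _ (openForm X))) := by
    rw [hφ, map_openForm]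
    simpa only [aeval_X] using hu
  refine ⟨IsLocalization.Away.liftAlgHom (S := OpenRing) _ hφu, fun j => ?_⟩
  rw [IsLocalization.Away.liftAlgHom_apply, genericPoint, IsLocalization.Away.lift_eq]
  exact aeval_X x j

theorem exists_algHom_paramRing (t : Fin 4 → T) (hu : IsUnit (paramForm t)) :
    ∃ f : ParamRing →ₐ[ℂ] T, ∀ i, f (genericParam i) = t i := by
  have hφu : IsUnit (aeval (R := ℂ) t (paramForm X)) := by
    rw [map_paramForm]
    simpa only [aeval_X] using hu
  refine ⟨IsLocalization.Away.liftAlgHom (S := ParamRing) _ hφu, fun i => ?_⟩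
  rw [IsLocalization.Away.liftAlgHom_apply, genericParam, IsLocalization.Away.lift_eq]
  exact aeval_X _ _

theorem openRing_algHom_ext {f g : OpenRing →ₐ[ℂ] T}
    (h : ∀ j, f (genericPoint j) = g (genericPoint j)) : f = g :=
  IsLocalization.algHom_ext
    (Submonoid.powers (Ideal.Quotient.mk (idealX.toIdeal ⊔ Ideal.span {X 7 - 1}) (openForm X)))
    (Ideal.Quotient.algHom_ext ℂ (MvPolynomial.algHom_ext h))

theorem paramRing_algHom_ext {f g : ParamRing →ₐ[ℂ] T}
    (h : ∀ i, f (genericParam i) = g (genericParam i)) : f = g :=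
  IsLocalization.algHom_ext (Submonoid.powers (paramForm (X : Fin 4 → MvPolynomial (Fin 4) ℂ)))
    (MvPolynomial.algHom_ext h)

theorem exists_mul_eq_one_genericParam :
    ∃ b m, paramLin genericParam * b = 1 ∧
      crossVec (liftPoint genericParam (-paramConst genericParam * b)) 1 * m = 1 := by
  obtain ⟨hlin, hminor⟩ := IsUnit.mul_iff.mp isUnit_paramForm_genericParam
  obtain ⟨b, hb⟩ := hlin.exists_right_inv
  obtain ⟨n, hn⟩ := hminor.exists_right_inv
  refine ⟨b, paramLin genericParam ^ 2 * n, hb, ?_⟩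
  rw [← mul_assoc, mul_comm (crossVec _ _), sq_mul_crossVec_liftPoint, hn]
  linear_combination -paramConst genericParam * hb

theorem exists_mul_eq_one_genericPoint :
    ∃ m, crossVec genericPoint 1 * m = 1 ∧ IsUnit (paramLin (pointParam genericPoint m)) := by
  obtain ⟨hcross, hpolar⟩ := IsUnit.mul_iff.mp isUnit_openForm_genericPoint
  obtain ⟨m, hm⟩ := (isUnit_of_mul_isUnit_right hcross).exists_right_inv
  refine ⟨m, hm, ?_⟩
  rw [paramLin_pointParam genericPoint_seven hm]
  exact ((IsUnit.of_mul_eq_one_right _ hm).pow 2).mul hpolar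

section Inverse

variable {b m : ParamRing} {m' : OpenRing} {f : OpenRing →ₐ[ℂ] ParamRing}
  {g : ParamRing →ₐ[ℂ] OpenRing}

theorem comp_eq_id_paramRing
    (hm : crossVec (liftPoint genericParam (-paramConst genericParam * b)) 1 * m = 1)
    (hm' : crossVec genericPoint 1 * m' = 1)
    (hf : ∀ j, f (genericPoint j) = paramPoint genericParam b m j)
    (hg : ∀ i, g (genericParam i) = pointParam genericPoint m' i) :
    f.comp g = AlgHom.id ℂ ParamRing := by
  have hfm : f m' = m := by
    have hnet : netParam genericParam 1 = 1 := rfl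
    have h := congrArg f hm'
    simp only [map_mul, map_one, map_crossVec, hf, crossVec_paramPoint, Pi.smul_apply, hnet,
      smul_eq_mul, mul_one] at h
    exact (IsUnit.of_mul_eq_one _ hm).mul_left_cancel (h.trans hm.symm)
  refine paramRing_algHom_ext fun i => ?_
  simp only [AlgHom.comp_apply, AlgHom.id_apply, hg, map_pointParam, hf, hfm]
  rw [pointParam_paramPoint _ _ _ hm]

theorem comp_eq_id_openRing (hb : paramLin genericParam * b = 1)
    (hm : crossVec (liftPoint genericParam (-paramConst genericParam * b)) 1 * m = 1)
    (hm' : crossVec genericPoint 1 * m' = 1)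
    (hf : ∀ j, f (genericPoint j) = paramPoint genericParam b m j)
    (hg : ∀ i, g (genericParam i) = pointParam genericPoint m' i) :
    g.comp f = AlgHom.id ℂ OpenRing := by
  have hgb : paramLin (pointParam genericPoint m') * g b = 1 := by
    simpa only [map_mul, map_one, map_paramLin, hg] using congrArg g hb
  have hgm : g m = m' := by
    have h := congrArg g hm
    simp only [map_mul, map_one, map_crossVec, map_liftPoint, map_neg, map_paramConst, hg] at h
    rw [liftPoint_pointParam_eq genericPoint_seven hm' quadVal_genericPoint hgb,
      crossVec_projTail] at h
    exact (IsUnit.of_mul_eq_one _ hm').mul_left_cancel (h.trans hm'.symm)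
  refine openRing_algHom_ext fun j => ?_
  simp only [AlgHom.comp_apply, AlgHom.id_apply, hf, map_paramPoint, hg, hgm]
  rw [paramPoint_pointParam genericPoint_seven hm' quadVal_genericPoint hgb]

end Inverse

theorem nonempty_openRing_algEquiv : Nonempty (OpenRing ≃ₐ[ℂ] ParamRing) := by
  obtain ⟨b, m, hb, hm⟩ := exists_mul_eq_one_genericParam
  obtain ⟨m', hm', hlin⟩ := exists_mul_eq_one_genericPoint
  obtain ⟨f, hf⟩ := exists_algHom_openRing (paramPoint genericParam b m)
    (quadVal_paramPoint _ b m hb hm) rfl (by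
      rw [openForm_paramPoint]
      exact ((IsUnit.of_mul_eq_one _ hm).pow 3).mul (IsUnit.of_mul_eq_one _ hb))
  obtain ⟨g, hg⟩ := exists_algHom_paramRing (pointParam genericPoint m') (by
    rw [paramForm, paramMinor_pointParam genericPoint_seven hm' quadVal_genericPoint]
    exact hlin.mul ((hlin.pow 2).mul (IsUnit.of_mul_eq_one _ hm')))
  exact ⟨AlgEquiv.ofAlgHom f g (comp_eq_id_paramRing hm hm' hf hg)
    (comp_eq_id_openRing hb hm hm' hf hg)⟩

end CoordinateRings

/-! ### The locus where the parametrization fails -/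

section LinearSection

/-- Four linear forms without common zero on the locus in the fourfold where `openForm` vanishes:
their number bounds the dimension of the cone over that locus. -/
def linForms {R : Type*} [CommRing R] (x : Fin 8 → R) : Fin 4 → R :=
  ![x 1, x 3, x 4 + 2 * x 0, x 5 - x 2]

section Ring

variable {R S F : Type*} [CommRing R] [CommRing S] [FunLike F R S] [RingHomClass F R S]

theorem map_linForms (f : F) (x : Fin 8 → R) (i : Fin 4) :
    f (linForms x i) = linForms (fun j => f (x j)) i := by
  fin_cases i <;> simp [linForms, map_ofNat]

theorem linForms_smul (c : R) (x : Fin 8 → R) (i : Fin 4) :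
    linForms (c • x) i = c * linForms x i := by
  fin_cases i <;> simp [linForms] <;> ring

theorem quadGrad_smul (c : R) (x : Fin 8 → R) (i : Fin 3) (j : Fin 8) :
    quadGrad (c • x) i j = c * quadGrad x i j := by
  rw [quadGrad_apply, smul_dotProduct, ← quadGrad_apply, smul_eq_mul]

theorem crossVec_smul (c : R) (x : Fin 8 → R) : crossVec (c • x) = c ^ 2 • crossVec x := by
  have hgrad (j : Fin 8) :
      (fun i => quadGrad (c • x) i j) = c • fun i => quadGrad x i j :=
    funext fun i => quadGrad_smul c x i j
  rw [crossVec, hgrad, hgrad, map_smul, map_smul, LinearMap.smul_apply, smul_smul, ← sq, crossVec]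

theorem projTail_smul (c : R) (x : Fin 8 → R) : projTail (c • x) = c • projTail x := by
  ext j
  fin_cases j <;> simp [projTail]

theorem openForm_smul (c : R) (x : Fin 8 → R) : openForm (c • x) = c ^ 8 * openForm x := by
  rw [openForm, crossVec_smul, sectionPolar_smul, projTail_smul]
  simp only [sectionPolar, quadGrad_smul, openForm, Fin.sum_univ_three, Pi.smul_apply,
    smul_eq_mul]
  ring

end Ring

section CharFive

variable {k : Type*} [Field k] [CharP k 5] {x : Fin 8 → k}

theorem exists_eq_smul_of_linForms_eq_zero (hQ : ∀ i, quadVal x i = 0)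
    (hl : ∀ i, linForms x i = 0) :
    ∃ a b : ℤ, (a = 0 ∨ a = 3) ∧ (b = -1 ∨ b = 2) ∧
      x = x 6 • fun j => ((![-2, 0, a, 0, 4, a, 1, b] j : ℤ) : k) := by
  have h5 : (5 : k) = 0 := CharP.cast_eq_zero k 5
  have x1 : x 1 = 0 := hl 0
  have x3 : x 3 = 0 := hl 1
  have x4 : x 4 = -(2 * x 0) := eq_neg_of_add_eq_zero_left (hl 2)
  have x5 : x 5 = x 2 := sub_eq_zero.mp (hl 3)
  have q0 := hQ 0
  have q1 := hQ 1
  have q2 := hQ 2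
  simp only [quadVal, Fin.isValue, Matrix.cons_val, x1, x3, x4, x5] at q0 q1 q2
  have x0 : x 0 = -2 * x 6 := by
    have h : (x 0 + 2 * x 6) ^ 2 = 0 := by
      linear_combination q0 + 4 * q1 + 4 * q2
        + (-3 * x 0 ^ 2 - 5 * x 6 ^ 2 - 11 * x 0 * x 2 - 11 * x 0 * x 7 - 14 * x 2 ^ 2
          - 13 * x 7 ^ 2 - 16 * x 0 * x 6 - 4 * x 2 * x 7) * h5
    linear_combination pow_eq_zero_iff two_ne_zero |>.mp h
  rw [x0] at q0 q1 q2
  have x7 : (x 7 + x 6) * (x 7 - 2 * x 6) = 0 := by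
    linear_combination 4 * q0 + 8 * q1 + 12 * q2
      + (-35 * x 7 ^ 2 + 59 * x 6 * x 7 + 50 * x 6 ^ 2 + 64 * x 2 * x 6 - 40 * x 2 ^ 2
        - 12 * x 2 * x 7) * h5
  have x2 : x 2 * (x 2 - 3 * x 6) = 0 := by
    linear_combination 2 * q1
      + (-x 2 ^ 2 + x 2 * x 6 - 2 * x 6 ^ 2 + 4 * x 6 * x 7 - 2 * x 7 ^ 2) * h5
  obtain ⟨a, ha, x2⟩ : ∃ a : ℤ, (a = 0 ∨ a = 3) ∧ x 2 = x 6 * a :=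
    (mul_eq_zero.mp x2).elim (fun h => ⟨0, .inl rfl, by simpa using h⟩)
      fun h => ⟨3, .inr rfl, by push_cast; linear_combination h⟩
  obtain ⟨b, hb, x7⟩ : ∃ b : ℤ, (b = -1 ∨ b = 2) ∧ x 7 = x 6 * b :=
    (mul_eq_zero.mp x7).elim (fun h => ⟨-1, .inl rfl, by push_cast; linear_combination h⟩)
      fun h => ⟨2, .inr rfl, by push_cast; linear_combination h⟩
  refine ⟨a, b, ha, hb, funext fun j => ?_⟩
  fin_cases j <;> simp [x0, x1, x2, x3, x4, x5, x7] <;> ring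

theorem eq_zero_of_linForms_eq_zero_of_charP_five (hQ : ∀ i, quadVal x i = 0)
    (hg : openForm x = 0) (hl : ∀ i, linForms x i = 0) : x = 0 := by
  obtain ⟨a, b, ha, hb, hx⟩ := exists_eq_smul_of_linForms_eq_zero hQ hl
  have h5 : ¬(5 : ℤ) ∣ openForm ![-2, 0, a, 0, 4, a, 1, b] := by
    rcases ha with rfl | rfl <;> rcases hb with rfl | rfl <;> decide +kernel
  have hopen : openForm (fun j => ((![-2, 0, a, 0, 4, a, 1, b] j : ℤ) : k)) ≠ 0 := fun h =>
    h5 ((CharP.intCast_eq_zero_iff k 5 _).mp ((map_openForm (Int.castRingHom k) _).trans h))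
  rw [hx, openForm_smul] at hg
  rw [hx, eq_zero_of_pow_eq_zero ((mul_eq_zero.mp hg).resolve_right hopen), zero_smul]

end CharFive

variable {K : Type*} [Field K]

theorem openForm_residue_eq_zero {V : ValuationSubring K} {c : K} {x : Fin 8 → K} {w : Fin 8 → V}
    (hw : ∀ j, (w j : K) = c * x j) (hg : openForm x = 0) :
    openForm (fun j => IsLocalRing.residue V (w j)) = 0 := by
  have hwx : (fun j => V.subtype (w j)) = c • x := funext hw
  have openForm_w : openForm w = 0 := Subtype.val_injective <| by
    change V.subtype (openForm w) = 0
    rw [map_openForm, hwx, openForm_smul, hg, mul_zero]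
  rw [← map_openForm, openForm_w, map_zero]

theorem linForms_residue {V : ValuationSubring K} {c l : V} {x : Fin 8 → K} {w : Fin 8 → V}
    (hw : ∀ j, (w j : K) = c * x j) {i : Fin 4} (hl : linForms x i = l) :
    linForms (fun j => IsLocalRing.residue V (w j)) i =
      IsLocalRing.residue V c * IsLocalRing.residue V l := by
  have hwx : (fun j => V.subtype (w j)) = (c : K) • x := funext hw
  have linForms_w : linForms w i = c * l := Subtype.val_injective <| by
    change V.subtype (linForms w i) = c * l
    rw [map_linForms, hwx, linForms_smul, hl]
  rw [← map_linForms, linForms_w, map_mul]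

theorem residue_eq_zero_of_inv_notMem {V : ValuationSubring K} {c : V} (hc : (c : K)⁻¹ ∉ V) :
    IsLocalRing.residue V c = 0 := by
  rw [IsLocalRing.residue_eq_zero_iff, IsLocalRing.mem_maximalIdeal]
  intro hu
  obtain ⟨d, hd⟩ := hu.exists_right_inv
  have hd' : (c : K) * d = 1 := congrArg Subtype.val hd
  exact hc (eq_inv_of_mul_eq_one_right hd' ▸ d.2)

theorem exists_residue_point {V : ValuationSubring K} {x : Fin 8 → K}
    (hQ : ∀ i, quadVal x i = 0) (hg : openForm x = 0) (hl : ∀ i, linForms x i ∈ V)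
    {j : Fin 8} (hj : x j ∉ V) :
    ∃ w : Fin 8 → IsLocalRing.ResidueField V, w ≠ 0 ∧ (∀ i, quadVal w i = 0) ∧ openForm w = 0 ∧
      ∀ i, linForms w i = 0 := by
  have hx : x ≠ 0 := fun h => hj (h ▸ V.zero_mem)
  obtain ⟨c, w, hw, i₀, hi₀⟩ := exists_smul_mem_valuationSubring V hx
  have hc0 : c ≠ 0 := fun h => by simpa [hi₀, h] using hw i₀
  have hc : c⁻¹ ∉ V := fun h => hj <| by
    rw [← inv_mul_cancel_left₀ hc0 (x j), ← hw]
    exact V.mul_mem _ _ h (w j).2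
  lift c to V using (V.mem_or_inv_mem c).resolve_right hc
  refine ⟨fun j => IsLocalRing.residue V (w j), fun h => ?_, quadVal_residue_eq_zero hw hQ,
    openForm_residue_eq_zero hw hg, fun i => ?_⟩
  · simpa [hi₀] using congrFun h i₀
  · rw [linForms_residue hw (l := ⟨linForms x i, hl i⟩) rfl, residue_eq_zero_of_inv_notMem hc,
      zero_mul]

theorem eq_zero_of_linForms_eq_zero [CharZero K] {x : Fin 8 → K} (hQ : ∀ i, quadVal x i = 0)
    (hg : openForm x = 0) (hl : ∀ i, linForms x i = 0) : x = 0 := by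
  by_contra hx
  obtain ⟨V, _⟩ := exists_valuationSubring_charP_residueField K Nat.prime_five
  obtain ⟨c, w, hw, j, hj⟩ := exists_smul_mem_valuationSubring V hx
  have linForms_w (i : Fin 4) : linForms w i = 0 := Subtype.val_injective <| by
    change V.subtype (linForms w i) = 0
    rw [map_linForms, show (fun j => V.subtype (w j)) = c • x from funext hw, linForms_smul, hl,
      mul_zero]
  have w_residue := eq_zero_of_linForms_eq_zero_of_charP_five (quadVal_residue_eq_zero hw hQ)
    (openForm_residue_eq_zero hw hg) fun i => by rw [← map_linForms, linForms_w, map_zero]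
  simpa [hj] using congrFun w_residue j

/-- A valuation ring containing `A` but not `x j` would specialize `x` to a nonzero common zero of
the linear forms. -/
theorem isIntegral_of_openForm_eq_zero (k : Type*) {A : Type*} [Field k] [CharZero k] [CommRing A]
    [Algebra k A] [Algebra A K] {x : Fin 8 → K} (hQ : ∀ i, quadVal x i = 0)
    (hg : openForm x = 0) (hl : ∀ i, linForms x i ∈ (algebraMap A K).range) (j : Fin 8) :
    IsIntegral A (x j) := by
  by_contra hj
  let B : Subring K := (integralClosure A K).toSubring
  have : IsIntegrallyClosedIn B K :=
    inferInstanceAs (IsIntegrallyClosedIn (integralClosure A K) K)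
  obtain ⟨V, hBV, hjV⟩ := B.exists_le_valuationSubring_of_isIntegrallyClosedIn (x := x j) hj
  have hAV (a : A) : algebraMap A K a ∈ V := hBV ((integralClosure A K).algebraMap_mem a)
  obtain ⟨w, hw0, hwQ, hwg, hwl⟩ := exists_residue_point hQ hg
    (fun i => by obtain ⟨a, ha⟩ := hl i; exact ha ▸ hAV a) hjV
  let φ : A →+* V := (algebraMap A K).codRestrict V hAV
  have : CharZero (IsLocalRing.ResidueField V) :=
    charZero_of_injective_ringHom
      (((IsLocalRing.residue V).comp φ).comp (algebraMap k A)).injective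
  exact hw0 (eq_zero_of_linForms_eq_zero hwQ hwg hwl)

end LinearSection

/-! ### Density of the open set -/

section Dimension

/-- The translation of affine space by `c`, as an automorphism of the polynomial ring. -/
def translate {σ K : Type*} [CommRing K] (c : σ → K) : MvPolynomial σ K ≃ₐ[K] MvPolynomial σ K :=
  AlgEquiv.ofAlgHom (aeval fun i => X i + C (c i)) (aeval fun i => X i - C (c i))
    (by ext i; simp) (by ext i; simp)

theorem vanishingIdeal_singleton_eq_comap_translate {σ K : Type*} [Field K] (a b : σ → K) :
    vanishingIdeal K {b} = (vanishingIdeal K {a}).comap (translate (b - a)).toRingEquiv := by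
  have h : (aeval (R := K) a).comp (translate (b - a)).toAlgHom = aeval b := by
    ext i
    simp [translate]
  ext p
  rw [Ideal.mem_comap, mem_vanishingIdeal_singleton_iff, mem_vanishingIdeal_singleton_iff, ← h]
  rfl

/-- Translations permute the maximal ideals transitively, so they all have the same height. -/
theorem height_eq_of_isMaximal {σ K : Type*} [Finite σ] [Field K] [IsAlgClosed K]
    {m : Ideal (MvPolynomial σ K)} (hm : m.IsMaximal) : m.height = Nat.card σ := by
  have hsame (m' : Ideal (MvPolynomial σ K)) (hm' : m'.IsMaximal) : m'.height = m.height := by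
    obtain ⟨a, rfl⟩ := isMaximal_iff_eq_vanishingIdeal_singleton.mp hm
    obtain ⟨b, rfl⟩ := isMaximal_iff_eq_vanishingIdeal_singleton.mp hm'
    rw [vanishingIdeal_singleton_eq_comap_translate a b]
    exact RingEquiv.height_comap _ _
  have hsup : (⨆ (I : Ideal (MvPolynomial σ K)) (_ : I.IsMaximal), I.height) = m.height :=
    le_antisymm (iSup₂_le fun I hI => (hsame I hI).le) (le_iSup₂_of_le m hm le_rfl)
  have hdim := Ideal.sup_isMaximal_height_eq_ringKrullDim (R := MvPolynomial σ K)
  rw [hsup, MvPolynomial.ringKrullDim_of_isNoetherianRing, ringKrullDim_eq_zero_of_field,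
    zero_add] at hdim
  exact_mod_cast hdim

theorem ringKrullDim_le_of_isIntegral (A B : Type*) [CommRing A] [CommRing B] [Algebra A B]
    [Algebra.IsIntegral A B] : ringKrullDim B ≤ ringKrullDim A :=
  Order.krullDim_le_of_strictMono (PrimeSpectrum.comap (algebraMap A B)) fun _ _ h =>
    Ideal.IsIntegral.comap_lt_comap h

theorem ringKrullDim_le_card_of_isIntegralElem {k D σ ι : Type*} [Field k] [CommRing D]
    [Algebra k D] [Finite σ] (t : σ → D) {x : ι → D} (hx : Algebra.adjoin k (Set.range x) = ⊤)
    (integral : ∀ j, (aeval (R := k) t).IsIntegralElem (x j)) : ringKrullDim D ≤ Nat.card σ := by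
  let _ : Algebra (MvPolynomial σ k) D := (aeval (R := k) t).toAlgebra
  have : IsScalarTower k (MvPolynomial σ k) D :=
    IsScalarTower.of_algebraMap_eq fun a => ((aeval t).commutes a).symm
  have hle : Algebra.adjoin k (Set.range x) ≤
      (integralClosure (MvPolynomial σ k) D).restrictScalars k :=
    Algebra.adjoin_le (Set.range_subset_iff.mpr integral)
  have : Algebra.IsIntegral (MvPolynomial σ k) D := ⟨fun d => hle (hx ▸ Algebra.mem_top)⟩
  refine (ringKrullDim_le_of_isIntegral (MvPolynomial σ k) D).trans_eq ?_
  rw [MvPolynomial.ringKrullDim_of_isNoetherianRing, ringKrullDim_eq_zero_of_field, zero_add]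

theorem length_le_ringKrullDim_quotient_head {R : Type*} [CommRing R]
    (p : LTSeries (PrimeSpectrum R)) : p.length ≤ ringKrullDim (R ⧸ p.head.asIdeal) := by
  rw [ringKrullDim_quotient]
  exact Order.LTSeries.length_le_krullDim
    { length := p.length
      toFun := fun i => ⟨p i, p.head_le i⟩
      step := fun i => p.step i }

theorem strictMono_comap_of_surjective {R S : Type*} [CommRing R] [CommRing S] {f : R →+* S}
    (hf : Function.Surjective f) : StrictMono (PrimeSpectrum.comap f) :=
  Monotone.strictMono_of_injective (fun _ _ hab _ h => hab h)
    (PrimeSpectrum.comap_injective_of_surjective f hf)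

theorem exists_isPrime_le_ringKrullDim_quotient {R : Type*} [CommRing R] {I m : Ideal R}
    [m.IsPrime] (hI : I ≤ m) {n : ℕ} (hn : n ≤ (m.map (Ideal.Quotient.mk I)).height) :
    ∃ P : Ideal R, P.IsPrime ∧ I ≤ P ∧ P ≤ m ∧ n ≤ ringKrullDim (R ⧸ P) := by
  let q := Ideal.Quotient.mk I
  have hm : (m.map q).IsPrime := Ideal.isPrime_map_quotientMk_of_isPrime hI
  rw [PrimeSpectrum.height_eq_orderHeight ⟨m.map q, hm⟩] at hn
  obtain ⟨p, hlast, rfl⟩ := Order.exists_series_of_le_height _ hn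
  have hcomap : (m.map q).comap q = m := by
    rw [Ideal.comap_map_of_surjective q Ideal.Quotient.mk_surjective, ← RingHom.ker_eq_comap_bot,
      Ideal.mk_ker, sup_eq_left.mpr hI]
  refine ⟨p.head.asIdeal.comap q, inferInstance, ?_, ?_, ?_⟩
  · exact Ideal.mk_ker.symm.trans_le (Ideal.ker_le_comap q)
  · have hle : p.head ≤ ⟨m.map q, hm⟩ := hlast ▸ p.head_le_last
    exact (Ideal.comap_mono hle).trans_eq hcomap
  · exact length_le_ringKrullDim_quotient_head
      (p.map _ (strictMono_comap_of_surjective Ideal.Quotient.mk_surjective))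

/-- By Krull's height theorem, the irreducible components of the zero locus of `s` have dimension
greater than `n`, so none of them is contained in the zero locus of `g`. -/
theorem mem_radical_span_of_mul_mem {σ K : Type*} [Finite σ] [Field K] [IsAlgClosed K]
    {s : Set (MvPolynomial σ K)} {f g : MvPolynomial σ K} {n : ℕ}
    (hs : (n + 1 : ℕ) + s.encard ≤ Nat.card σ)
    (hg : ∀ P : Ideal (MvPolynomial σ K), P.IsPrime → Ideal.span s ≤ P → g ∈ P →
      ringKrullDim (MvPolynomial σ K ⧸ P) ≤ n)
    (hfg : f * g ∈ (Ideal.span s).radical) : f ∈ (Ideal.span s).radical := by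
  by_contra hf
  rw [Ideal.radical_eq_jacobson, Ideal.jacobson, Ideal.mem_sInf] at hf
  push Not at hf
  obtain ⟨m, ⟨hsm, hm⟩, hfm⟩ := hf
  have hfin : s.encard ≠ ⊤ := fun h => by simp [h] at hs
  have hheight := Ideal.height_le_height_add_encard_of_subset s (p := m) (Ideal.span_le.mp hsm)
  rw [height_eq_of_isMaximal hm] at hheight
  obtain ⟨P, hP, hsP, hPm, hdim⟩ := exists_isPrime_le_ringKrullDim_quotient hsm
    ((ENat.add_le_add_iff_right hfin).mp (hs.trans hheight))
  have hgP : g ∈ P :=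
    (hP.mem_or_mem (hP.radical_le_iff.mpr hsP hfg)).resolve_left fun h => hfm (hPm h)
  exact absurd (Nat.cast_le.mp (hdim.trans (hg P hP hsP hgP))) (by lia)

theorem ringKrullDim_quotient_le_four {P : Ideal (MvPolynomial (Fin 8) ℂ)} (hP : P.IsPrime)
    (hI : idealX.toIdeal ≤ P) (hg : openForm X ∈ P) :
    ringKrullDim (MvPolynomial (Fin 8) ℂ ⧸ P) ≤ (4 : ℕ) := by
  let D := MvPolynomial (Fin 8) ℂ ⧸ P
  let x : Fin 8 → D := fun j => Ideal.Quotient.mk P (X j)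
  have hx : Algebra.adjoin ℂ (Set.range x) = ⊤ := by
    have h := congrArg (Subalgebra.map (Ideal.Quotient.mkₐ ℂ P)) (adjoin_range_X (R := ℂ))
    rwa [AlgHom.map_adjoin, ← Set.range_comp, Algebra.map_top,
      (AlgHom.range_eq_top _).mpr (Ideal.Quotient.mkₐ_surjective ℂ P)] at h
  have hQ (i : Fin 3) : quadVal x i = 0 := by
    have h : quadric i ∈ P := hI (Ideal.subset_span ⟨i, rfl⟩)
    rwa [quadric_eq_quadVal_X, ← Ideal.Quotient.eq_zero_iff_mem, map_quadVal] at h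
  rw [← Ideal.Quotient.eq_zero_iff_mem, map_openForm] at hg
  rw [← Nat.card_fin 4]
  refine ringKrullDim_le_card_of_isIntegralElem (linForms x) hx fun j => ?_
  let _ : Algebra (MvPolynomial (Fin 4) ℂ) D := (aeval (linForms x)).toAlgebra
  let ι := algebraMap D (FractionRing D)
  refine (isIntegral_algebraMap_iff (IsFractionRing.injective D (FractionRing D))).mp
    (isIntegral_of_openForm_eq_zero ℂ (x := fun j => ι (x j)) (fun i => ?_) ?_ (fun i => ?_) j)
  · rw [← map_quadVal, hQ, map_zero]
  · rw [← map_openForm, hg, map_zero]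
  · refine ⟨X i, ?_⟩
    rw [IsScalarTower.algebraMap_apply _ D, ← map_linForms]
    exact congrArg ι (aeval_X _ _)

theorem mem_radical_of_mul_openForm_mem {f : MvPolynomial (Fin 8) ℂ}
    (hf : f * openForm X ∈ idealX.toIdeal.radical) : f ∈ idealX.toIdeal.radical := by
  refine mem_radical_span_of_mul_mem (n := 4) ?_ (fun P => ringKrullDim_quotient_le_four) hf
  have hcard : (Set.range quadric).encard ≤ 3 := by
    rw [← Set.image_univ]
    exact (Set.encard_image_le _ _).trans (by simp [Set.encard_univ])
  refine (add_le_add_right hcard _).trans ?_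
  rw [Nat.card_fin]
  norm_num

end Dimension

section Density

theorem isHomogeneous_quadGrad {σ : Type*} {x : Fin 8 → MvPolynomial σ ℂ}
    (hx : ∀ j, (x j).IsHomogeneous 1) (i : Fin 3) (j : Fin 8) :
    (quadGrad x i j).IsHomogeneous 1 := by
  have h : quadGrad x i j = aeval x (pderiv j (quadric i)) := by
    rw [pderiv_quadric, map_quadGrad]
    simp only [aeval_X]
  rw [h]
  exact (isHomogeneous_quadric i).pderiv.aeval x hx

theorem isHomogeneous_projTail (j : Fin 8) :
    (projTail (X : Fin 8 → MvPolynomial (Fin 8) ℂ) j).IsHomogeneous 1 := by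
  fin_cases j
  · exact isHomogeneous_zero _ _ _
  · exact isHomogeneous_zero _ _ _
  all_goals exact isHomogeneous_X _ _

theorem isHomogeneous_crossVec (i : Fin 3) :
    (crossVec (X : Fin 8 → MvPolynomial (Fin 8) ℂ) i).IsHomogeneous 2 := by
  have hX := isHomogeneous_quadGrad (isHomogeneous_X ℂ (σ := Fin 8))
  rw [crossVec, cross_apply]
  fin_cases i <;> exact ((hX _ _).mul (hX _ _)).sub ((hX _ _).mul (hX _ _))

theorem isHomogeneous_openForm :
    (openForm (X : Fin 8 → MvPolynomial (Fin 8) ℂ)).IsHomogeneous 8 := by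
  have hc := isHomogeneous_crossVec
  have ht := isHomogeneous_quadGrad isHomogeneous_projTail
  refine ((isHomogeneous_X ℂ (7 : Fin 8)).mul (hc 1)).mul (n := 5) ?_
  refine IsHomogeneous.sum _ _ _ fun i _ => (hc i).mul (n := 3) ?_
  exact (((ht _ _).mul (hc _)).add ((ht _ _).mul (hc _))).add ((ht _ _).mul (hc _))

/-- The class of `openForm` in the homogeneous coordinate ring of the fourfold. -/
def openElem : MvPolynomial (Fin 8) ℂ ⧸ idealX.toIdeal := Ideal.Quotient.mk _ (openForm X)

theorem openElem_mem : openElem ∈ quotGrading idealX 8 :=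
  mk_mem_quotGrading idealX isHomogeneous_openForm

theorem isNilpotent_of_mul_openElem (a : MvPolynomial (Fin 8) ℂ ⧸ idealX.toIdeal)
    (h : IsNilpotent (a * openElem)) : IsNilpotent a := by
  obtain ⟨p, rfl⟩ := Ideal.Quotient.mk_surjective a
  obtain ⟨n, hn⟩ := h
  rw [openElem, ← map_mul, ← map_pow, Ideal.Quotient.eq_zero_iff_mem] at hn
  obtain ⟨k, hk⟩ := mem_radical_of_mul_openForm_mem ⟨n, hn⟩
  exact ⟨k, by rw [← map_pow]; exact Ideal.Quotient.eq_zero_iff_mem.mpr hk⟩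

variable {A K : Type*} [CommRing A] [CommRing K] [Algebra K A] (𝒜 : ℕ → Submodule K A)
  [GradedAlgebra 𝒜] {f g : A} {n : ℕ}

theorem nontrivial_away_of_not_isNilpotent (h : ¬IsNilpotent f) :
    Nontrivial (HomogeneousLocalization.Away 𝒜 f) := by
  by_contra hs
  rw [not_nontrivial_iff_subsingleton] at hs
  have h1 := congrArg HomogeneousLocalization.val
    (Subsingleton.elim (1 : HomogeneousLocalization.Away 𝒜 f) 0)
  rw [HomogeneousLocalization.val_one, HomogeneousLocalization.val_zero,
    ← map_one (algebraMap A _), ← map_zero (algebraMap A _),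
    IsLocalization.eq_iff_exists (Submonoid.powers f)] at h1
  obtain ⟨⟨_, k, rfl⟩, hk⟩ := h1
  exact h ⟨k, by simpa using hk⟩

theorem exists_mem_basicOpen_of_not_isNilpotent (hf : f ∈ 𝒜 n) (hn : 0 < n)
    (h : ¬IsNilpotent f) : ∃ y : Proj 𝒜, y ∈ Proj.basicOpen 𝒜 f := by
  have := nontrivial_away_of_not_isNilpotent 𝒜 h
  obtain ⟨z⟩ : Nonempty (PrimeSpectrum (HomogeneousLocalization.Away 𝒜 f)) := inferInstance
  refine ⟨Proj.awayι 𝒜 f hf hn z, ?_⟩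
  rw [← Proj.opensRange_awayι 𝒜 f hf hn]
  exact ⟨z, rfl⟩

theorem dense_basicOpen (hg : g ∈ 𝒜 n) (hn : 0 < n)
    (hnil : ∀ a, IsNilpotent (a * g) → IsNilpotent a) :
    Dense (Proj.basicOpen 𝒜 g : Set (Proj 𝒜)) := by
  rw [dense_iff_inter_open]
  rintro U hU ⟨x, hx⟩
  obtain ⟨_, ⟨f, rfl⟩, hxf, hfU⟩ :=
    TopologicalSpace.Opens.isBasis_iff_nbhd.mp (Proj.isBasis_basicOpen 𝒜) (U := ⟨U, hU⟩) hx
  rw [Proj.basicOpen_eq_iSup_proj] at hxf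
  obtain ⟨k, hk⟩ := TopologicalSpace.Opens.mem_iSup.mp hxf
  set a := GradedRing.proj 𝒜 k f
  have ha : a * g ∈ 𝒜 (k + n) := SetLike.mul_mem_graded (SetLike.coe_mem _) hg
  have hag : ¬IsNilpotent (a * g) := fun h => by
    obtain ⟨r, hr⟩ := hnil a h
    exact hk (x.isPrime.mem_of_pow_mem r (hr ▸ zero_mem _))
  obtain ⟨y, hy⟩ := exists_mem_basicOpen_of_not_isNilpotent 𝒜 ha (by lia) hag
  rw [Proj.basicOpen_mul] at hy
  refine ⟨y, hfU ?_, hy.2⟩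
  rw [Proj.basicOpen_eq_iSup_proj]
  exact TopologicalSpace.Opens.mem_iSup.mpr ⟨k, hy.1⟩

theorem dense_basicOpen_openElem :
    Dense (Proj.basicOpen (quotGrading idealX) openElem : Set (Proj (quotGrading idealX))) :=
  dense_basicOpen _ openElem_mem (by norm_num) isNilpotent_of_mul_openElem

end Density

/-! ### Rationality -/

section Rationality

universe u

/-- The inclusion of the open subset of the fourfold where `openForm` does not vanish. -/
def openι : Spec (CommRingCat.of OpenRing) ⟶ projScheme idealX :=
  Spec.map (CommRingCat.ofHom (algebraMap (ChartRing idealX 7) OpenRing)) ≫ chartι idealX 7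

instance isOpenImmersion_openι : IsOpenImmersion openι := IsOpenImmersion.comp _ _

theorem basicOpen_openElem_le :
    Proj.basicOpen (quotGrading idealX) openElem ≤
      Proj.basicOpen (quotGrading idealX) (coord idealX 7) := by
  have h : openElem = coord idealX 7 *
      Ideal.Quotient.mk _ (crossVec X 1 * sectionPolar (crossVec X) (projTail X)) := by
    rw [openElem, openForm, mul_assoc, map_mul, coord]
  rw [h, Proj.basicOpen_mul]
  exact inf_le_left

theorem chartEquiv_isLocalizationElem_openElem :
    chartEquiv idealX 7 (HomogeneousLocalization.Away.isLocalizationElem (coord_mem idealX 7)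
      openElem_mem) = Ideal.Quotient.mk _ (openForm X) := by
  refine (chartEquiv_mk idealX 7 8 (openForm X ^ 1) _).trans ?_
  rw [pow_one]

theorem basicOpen_openElem_subset_range_openι :
    (Proj.basicOpen (quotGrading idealX) openElem : Set (Proj (quotGrading idealX))) ⊆
      Set.range openι := by
  intro y hy
  have hy7 := basicOpen_openElem_le hy
  rw [← Proj.opensRange_awayι (quotGrading idealX) (coord idealX 7) (coord_mem idealX 7) one_pos]
    at hy7
  obtain ⟨z, rfl⟩ := hy7
  have hz : z ∈ Proj.awayι (quotGrading idealX) (coord idealX 7) (coord_mem idealX 7) one_pos ⁻¹ᵁ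
      Proj.basicOpen (quotGrading idealX) openElem := hy
  rw [Proj.awayι_preimage_basicOpen (quotGrading idealX) (coord_mem idealX 7) one_pos openElem_mem
    (by norm_num)] at hz
  obtain ⟨z, rfl⟩ :=
    (Spec.map (CommRingCat.ofHom (chartEquiv idealX 7).toRingHom)).surjective z
  have hz' : z ∈ PrimeSpectrum.basicOpen (Ideal.Quotient.mk
      (idealX.toIdeal ⊔ Ideal.span {X 7 - 1}) (openForm X)) := by
    rw [← chartEquiv_isLocalizationElem_openElem]
    exact hz
  obtain ⟨w, rfl⟩ := (PrimeSpectrum.localization_away_comap_range OpenRing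
    (Ideal.Quotient.mk (idealX.toIdeal ⊔ Ideal.span {X 7 - 1}) (openForm X))).ge hz'
  exact ⟨w, rfl⟩

instance isDominant_openι : IsDominant openι :=
  ⟨dense_basicOpen_openElem.mono basicOpen_openElem_subset_range_openι⟩

theorem openι_comp_projStr :
    openι ≫ projStr idealX = Spec.map (CommRingCat.ofHom (algebraMap ℂ OpenRing)) := by
  rw [openι, Category.assoc, chartι_comp_projStr, ← Spec.map_comp,
    ← CommRingCat.ofHom_comp, ← IsScalarTower.algebraMap_eq]

theorem paramForm_X_ne_zero : paramForm (X : Fin 4 → MvPolynomial (Fin 4) ℂ) ≠ 0 := by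
  intro h
  have int_ne_zero : paramForm (0 : Fin 4 → ℤ) ≠ 0 := by decide +kernel
  have heval := congrArg (eval fun _ => ((0 : ℤ) : ℂ)) h
  simp only [map_paramForm, eval_X, map_zero] at heval
  exact int_ne_zero (Int.cast_eq_zero.mp ((map_paramForm (Int.castRingHom ℂ) 0).trans heval))

/-- The inclusion of the open subset of affine space where `paramForm` does not vanish. -/
def paramι : Spec (CommRingCat.of ParamRing) ⟶ 𝔸(Fin 4; Spec (CommRingCat.of ℂ)) :=
  Spec.map (CommRingCat.ofHom (algebraMap (MvPolynomial (Fin 4) ℂ) ParamRing)) ≫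
    (AffineSpace.SpecIso (Fin 4) (CommRingCat.of ℂ)).inv

instance isOpenImmersion_paramι : IsOpenImmersion paramι := IsOpenImmersion.comp _ _

theorem isDominant_specMap_of_injective {A B : Type u} [CommRing A] [CommRing B] {f : A →+* B}
    (hf : Function.Injective f) : IsDominant (Spec.map (CommRingCat.ofHom f)) := by
  refine ⟨PrimeSpectrum.denseRange_comap_iff_ker_le_nilRadical _ |>.mpr ?_⟩
  exact ((RingHom.injective_iff_ker_eq_bot _).mp hf).trans_le bot_le

instance isDominant_paramι : IsDominant paramι := by
  have := isDominant_specMap_of_injective (f := algebraMap (MvPolynomial (Fin 4) ℂ) ParamRing)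
    (IsLocalization.injective _ (powers_le_nonZeroDivisors_of_noZeroDivisors paramForm_X_ne_zero))
  unfold paramι
  infer_instance

theorem paramι_comp_over :
    paramι ≫ (𝔸(Fin 4; Spec (CommRingCat.of ℂ)) ↘ Spec (CommRingCat.of ℂ))
      = Spec.map (CommRingCat.ofHom (algebraMap ℂ ParamRing)) := by
  rw [paramι, Category.assoc, AffineSpace.SpecIso_inv_over, ← Spec.map_comp,
    ← CommRingCat.ofHom_comp]
  rfl

theorem birationalOver_fourfoldStr :
    Scheme.BirationalOver fourfoldStr
      (𝔸(Fin 4; Spec (CommRingCat.of ℂ)) ↘ Spec (CommRingCat.of ℂ)) := by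
  obtain ⟨e⟩ := nonempty_openRing_algEquiv
  have : IsIso (Spec.map (CommRingCat.ofHom (e : OpenRing →+* ParamRing))) :=
    inferInstanceAs (IsIso (Spec.map e.toRingEquiv.toCommRingCatIso.hom))
  have h : Scheme.BirationalOver (Spec.map (CommRingCat.ofHom (algebraMap ℂ ParamRing)))
      (projStr idealX) :=
    (Spec.map (CommRingCat.ofHom (e : OpenRing →+* ParamRing)) ≫ openι).birationalOver _ _ (by
      rw [Category.assoc, openι_comp_projStr, ← Spec.map_comp, ← CommRingCat.ofHom_comp]
      congr 2
      exact e.toAlgHom.comp_algebraMap)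
  exact h.symm.trans (paramι.birationalOver _ _ paramι_comp_over)

end Rationality

end ThreeQuadrics

end

open ThreeQuadrics in
theorem proposition3p4 :
    -- `X` is smooth over `ℂ`, of dimension four
    SmoothOfRelativeDimension 4 fourfoldStr ∧
    -- `X` is rational
    Scheme.BirationalOver fourfoldStr
      (𝔸(Fin 4; Spec (CommRingCat.of ℂ)) ↘ Spec (CommRingCat.of ℂ)) ∧
    -- `X` contains the line `x_2 = … = x_7 = 0`
    (∃ j : projScheme idealLine ⟶ fourfold, j ≫ projEmb idealX = projEmb idealLine) ∧
    -- the associated bundle is a quadric surface bundle with smooth general fibre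
    (∀ l, IsQuadricSurface (bundleFiber l)) ∧
    (∃ (d : ℕ) (D : MvPolynomial (Fin 3) ℂ), D.IsHomogeneous d ∧ D ≠ 0 ∧
      ∀ l, eval l.rep D ≠ 0 → IsSmoothQuadricSurface (bundleFiber l)) ∧
    -- the explicit rational section
    IsRationalSection ![X 0, X 1, X 2, 0, 0, 0] := by
  exact ⟨smoothOfRelativeDimension_fourfoldStr, birationalOver_fourfoldStr,
    exists_comp_projEmb_eq idealX_le_idealLine,
    fun l => ⟨fiberSpace l.rep, fiberForm l.rep, fiberForm_ne_zero l.rep_nonzero,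
      isQuadricIn_bundleFiber l⟩,
    ⟨8, netDisc, isHomogeneous_netDisc, netDisc_ne_zero, fun l hl =>
      ⟨fiberSpace l.rep, fiberForm l.rep, nondegenerate_fiberForm (by rwa [eval_netDisc] at hl),
        isQuadricIn_bundleFiber l⟩⟩,
    isRationalSection_net⟩
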